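/- Let $s\ge 4$ be an integer, let $I\subset\mathbb R$ be an interval and $J\subset I$ a compact set, and let $\kappa:I\to(0,\infty)$ be of class $C^{s+2}$ and $p:I\to\mathbb R$ of class $C^{s+1}$ (for instance, both smooth). Consider the quasilinear Korteweg--de Vries equation $$\text{(qKdV)}\qquad \partial_t v+\partial_x\big(p(v)\big)+\partial_x\Big(\sqrt{\kappa(v)}\,\partial_x\big(\sqrt{\kappa(v)}\,\partial_x v\big)\Big)=0 ,\qquad x\in\mathbb R .$$ There is a nondecreasing function $C_s:\mathbb R\to\mathbb R$, depending only on $s,I,J,\kappa,p$, such that the following holds for every $T>0$ and every $v_0\in H^s(\mathbb R)$. Let $v$ be a smooth solution of (qKdV) on $[0,T]\times\mathbb R$ with $v(0,\cdot)=v_0$ and with values in $J$, where smooth means $$v\in C([0,T];H^{s+3}(\mathbb R))\cap C^1([0,T];H^{s}(\mathbb R))$$ (in particular every solution in $C([0,T];H^\infty(\mathbb R))\cap C^1([0,T];H^\infty(\mathbb R))$ is admitted), $v(t,\cdot)$ being the continuous representative. Then, for all $t\in[0,T]$, the quantity $$M_t=\sup_{0\le\tau\le t}\|v(\tau,\cdot)\|_{W^{3,\infty}(\mathbb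 R)}$$ is finite and $$\|v(t,\cdot)\|_{H^s(\mathbb R)}\le C_s(M_t)\,e^{C_s(M_t)\,t}\,\|v_0\|_{H^s(\mathbb R)} .$$ Here $\|f\|_{H^s}^2=\sum_{l\le s}\|\partial_x^l f\|_{L^2}^2$ and $\|f\|_{W^{3,\infty}}=\sum_{l\le 3}\|\partial_x^l f\|_{L^\infty}$, with weak derivatives. -/

import Mathlib

open Set Filter Topology MeasureTheory
open scoped ENNReal ContDiff

noncomputable section

namespace QKdV

/-- `g` is the `l`-th distributional derivative of `f` on the real line. -/
def HasWeakDeriv (l : ℕ) (f g : ℝ → ℝ) : Prop :=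
  LocallyIntegrable f ∧ LocallyIntegrable g ∧
    ∀ φ : ℝ → ℝ, ContDiff ℝ ∞ φ → HasCompactSupport φ →
      ∫ x, f x * iteratedDeriv l φ x = (-1) ^ l * ∫ x, g x * φ x

theorem HasWeakDeriv.ae_eq {l : ℕ} {f g g' : ℝ → ℝ} (h : HasWeakDeriv l f g)
    (h' : HasWeakDeriv l f g') : g =ᵐ[volume] g' := by
  refine ae_eq_of_integral_contDiff_smul_eq h.2.1 h'.2.1 ?_
  intro φ hφ hc
  have e := (h.2.2 φ hφ hc).symm.trans (h'.2.2 φ hφ hc)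
  have e' := mul_left_cancel₀ (pow_ne_zero l (by norm_num : (-1 : ℝ) ≠ 0)) e
  simpa only [smul_eq_mul, mul_comm] using e'

/-- The `L^q` norm of the `l`-th weak derivative of `f`; it is `∞` when `f` has no such
derivative. Weak derivatives are unique almost everywhere, so the infimum runs over at most one
value. -/
def derivNorm (l : ℕ) (q : ℝ≥0∞) (f : ℝ → ℝ) : ℝ≥0∞ :=
  ⨅ (g : ℝ → ℝ) (_ : HasWeakDeriv l f g), eLpNorm g q volume

theorem HasWeakDeriv.derivNorm_eq {l : ℕ} {f g : ℝ → ℝ} (h : HasWeakDeriv l f g) (q : ℝ≥0∞) :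
    derivNorm l q f = eLpNorm g q volume :=
  le_antisymm (iInf₂_le g h) (le_iInf₂ fun _ h' => (eLpNorm_congr_ae (h.ae_eq h')).le)

/-- The Sobolev space `H^k(ℝ)`: all weak derivatives of order at most `k` lie in `L²(ℝ)`. -/
def MemH (k : ℕ) (f : ℝ → ℝ) : Prop :=
  ∀ l ≤ k, ∃ g : ℝ → ℝ, HasWeakDeriv l f g ∧ MemLp g 2 volume

/-- The norm of `H^k(ℝ)`: `(∑_{l ≤ k} ‖∂ₓˡ f‖²_{L²})^{1/2}`, infinite outside `H^k(ℝ)`. -/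
def hNorm (k : ℕ) (f : ℝ → ℝ) : ℝ≥0∞ :=
  (∑ l ∈ Finset.range (k + 1), derivNorm l 2 f ^ 2) ^ (1 / 2 : ℝ)

/-- The norm of `W^{m,∞}(ℝ)`: `∑_{l ≤ m} ‖∂ₓˡ f‖_{L^∞}`, infinite outside `W^{m,∞}(ℝ)`. -/
def wInfNorm (m : ℕ) (f : ℝ → ℝ) : ℝ≥0∞ :=
  ∑ l ∈ Finset.range (m + 1), derivNorm l ⊤ f

/-- `u ∈ C([0,T]; H^k(ℝ))`, where `u t` stands for `u(t, ·)`. -/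
def ContinuousInH (k : ℕ) (T : ℝ) (u : ℝ → ℝ → ℝ) : Prop :=
  ∀ t ∈ Icc 0 T, MemH k (u t) ∧
    Tendsto (fun τ => hNorm k (fun x => u τ x - u t x)) (𝓝[Icc 0 T] t) (𝓝 0)

/-- `w` is the time derivative of `u` as an `H^k(ℝ)`-valued function on `[0,T]` (one-sided at the
end points). -/
def HasTimeDerivInH (k : ℕ) (T : ℝ) (u w : ℝ → ℝ → ℝ) : Prop :=
  ∀ t ∈ Icc 0 T,
    Tendsto (fun τ => hNorm k (fun x => (u τ x - u t x) / (τ - t) - w t x))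
      (𝓝[Icc 0 T \ {t}] t) (𝓝 0)

/-- `v` is a solution on `[0,T] × ℝ`, with initial value `v₀`, of
`∂ₜ v + ∂ₓ (p(v)) + ∂ₓ (√κ(v) ∂ₓ (√κ(v) ∂ₓ v)) = 0`
in the class `C([0,T]; H^m(ℝ)) ∩ C¹([0,T]; H^{m-3}(ℝ))`. Each `v(t, ·)` is the continuous
representative of its class, and `w` is `∂ₜ v`. -/
structure IsSolution (κ p : ℝ → ℝ) (m : ℕ) (T : ℝ) (v₀ : ℝ → ℝ) (v : ℝ → ℝ → ℝ) : Prop where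
  continuous : ∀ t ∈ Icc 0 T, Continuous (v t)
  continuousInH : ContinuousInH m T v
  equation : ∃ w : ℝ → ℝ → ℝ, ContinuousInH (m - 3) T w ∧ HasTimeDerivInH (m - 3) T v w ∧
    ∀ t ∈ Icc 0 T, ∀ᵐ x : ℝ,
      w t x + deriv (fun y => p (v t y)) x
        + deriv (fun y => √(κ (v t y)) * deriv (fun z => √(κ (v t z)) * deriv (v t) z) y) x = 0
  initial : v 0 = v₀

/-- The norm of `v` in `L^∞(0, t; W^{3,∞}(ℝ))`, as a supremum over all times in `[0,t]`. -/
def w3Sup (v : ℝ → ℝ → ℝ) (t : ℝ) : ℝ≥0∞ :=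
  ⨆ τ ∈ Icc 0 t, wInfNorm 3 (v τ)

end QKdV

end

namespace QKdV

/-! ### Weak derivatives -/

/-! In flux form the equation is ∂ₜv = -∂ₓF with F = κ(v)v_xx + ½κ'(v)v_x² + p(v). For u = ∂ₓˡv with
1 ≤ l ≤ s, ∂ₓˡF equals κu_xx + (l+1)κ'v_x u_x + (coefficient)·u + R. The plain energy ∫u² loses a
derivative: integration by parts leaves a multiple of ∫κ'v_x u_x². With a weight ρ(v), the terms in
v_x u_x² carry the factor (l+½)ρκ' - (3/2)ρ'κ, which vanishes when ρ'κ = ((2l+1)/3)ρκ'. This is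
solved by ρ = κ^((2l+1)/3), the function `weight`; the cancellation is carried out in
`exists_flux_pairing_bound`.

What is left is u² times a function of the 3-jet of v, and ∫ρu∂ₓR. When the time derivative falls on
the weight it gives ∫ρ'(v)∂ₜv·u², and ∂ₜv = -∂ₓF again depends on the 3-jet only. This is where the
W^{3,∞} norm comes from.

The term ∂ₓR is a differential polynomial of total order at most l+3 in factors of order at most s.
Its L² norm is at most C(M)‖v‖_{H^s} (`DiffPoly.tame`): only the excess of each order over 3
matters, and Gagliardo–Nirenberg applied to the bounded function ∂ₓ³v distributes it among the
factors. Since the weights are bounded above and below on bounded sets, the sum of the weighted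
energies is comparable to ‖v‖²_{H^s}, and Grönwall's inequality concludes (`exists_hSq_le`).

Regularity is tight. A function in H^{s+3} has s+2 classical derivatives, so ∂ₓˢF is continuous but
only weakly differentiable; the integration by parts against it uses absolutely continuous
primitives. Time derivatives are taken in L², and the weight is differentiated uniformly in x by
Sobolev embedding (`Evolves.uniform`). -/

theorem iteratedDeriv_compactSupport {φ : ℝ → ℝ} (hc : HasCompactSupport φ) (l : ℕ) :
    HasCompactSupport (iteratedDeriv l φ) := by
  induction l with
  | zero => simpa using hc
  | succ l ih => rw [iteratedDeriv_succ]; exact ih.deriv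

theorem contDiff_iteratedDeriv_infty {φ : ℝ → ℝ} (h : ContDiff ℝ ∞ φ) (l : ℕ) :
    ContDiff ℝ ∞ (iteratedDeriv l φ) := by
  rw [iteratedDeriv_eq_iterate]; exact h.iterate_deriv l

theorem hasDerivAt_iteratedDeriv {n l : ℕ} {f : ℝ → ℝ} (hf : ContDiff ℝ n f) (hl : l < n) (x : ℝ) :
    HasDerivAt (iteratedDeriv l f) (iteratedDeriv (l + 1) f x) x := by
  rw [iteratedDeriv_succ]
  exact ((hf.differentiable_iteratedDeriv l (by exact_mod_cast hl)) x).hasDerivAt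

theorem integral_mul_iteratedDeriv_eq {l : ℕ} {f : ℝ → ℝ} (hf : ContDiff ℝ l f) {φ : ℝ → ℝ}
    (hφ : ContDiff ℝ ∞ φ) (hc : HasCompactSupport φ) :
    ∫ x, f x * iteratedDeriv l φ x = (-1) ^ l * ∫ x, iteratedDeriv l f x * φ x := by
  induction l generalizing φ with
  | zero => simp
  | succ l ih =>
    have h1 := ih (hf.of_le (by exact_mod_cast Nat.le_succ l)) (φ := deriv φ)
      (by simpa using contDiff_iteratedDeriv_infty hφ 1) hc.deriv
    rw [iteratedDeriv_succ', h1, pow_succ, mul_assoc]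
    congr 1
    have hcf : Continuous (iteratedDeriv l f) :=
      hf.continuous_iteratedDeriv l (by exact_mod_cast Nat.le_succ l)
    have hcf' : Continuous (iteratedDeriv (l + 1) f) := hf.continuous_iteratedDeriv (l + 1) le_rfl
    have hφ1 : Continuous (deriv φ) := hφ.continuous_deriv (by simp)
    rw [integral_mul_deriv_eq_deriv_mul_of_integrable (u' := iteratedDeriv (l + 1) f)
      (fun x _ => hasDerivAt_iteratedDeriv hf (Nat.lt_succ_self l) x)
      (fun x _ => ((hφ.differentiable (by simp)) x).hasDerivAt)]
    · simp
    · exact (hcf.mul hφ1).integrable_of_hasCompactSupport hc.deriv.mul_left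
    · exact (hcf'.mul hφ.continuous).integrable_of_hasCompactSupport hc.mul_left
    · exact (hcf.mul hφ.continuous).integrable_of_hasCompactSupport hc.mul_left

theorem hasWeakDeriv_iteratedDeriv {l : ℕ} {f : ℝ → ℝ} (hf : ContDiff ℝ l f) :
    HasWeakDeriv l f (iteratedDeriv l f) :=
  ⟨hf.continuous.locallyIntegrable, (hf.continuous_iteratedDeriv l le_rfl).locallyIntegrable,
    fun _ hφ hc => integral_mul_iteratedDeriv_eq hf hφ hc⟩

theorem integrable_mul_test {f φ : ℝ → ℝ} (hf : LocallyIntegrable f)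
    (hφ : Continuous φ) (hc : HasCompactSupport φ) : Integrable fun x => f x * φ x := by
  have := hf.integrable_smul_right_of_hasCompactSupport hφ hc
  simpa [smul_eq_mul] using this

theorem intervalIntegrable_of_locallyIntegrable {f : ℝ → ℝ} (hf : LocallyIntegrable f) (a b : ℝ) :
    IntervalIntegrable f volume a b :=
  (hf.integrableOn_isCompact isCompact_uIcc).intervalIntegrable

theorem HasWeakDeriv.congr_ae {l : ℕ} {f f' g g' : ℝ → ℝ} (h : HasWeakDeriv l f g)
    (hf : f =ᵐ[volume] f') (hg : g =ᵐ[volume] g') : HasWeakDeriv l f' g' := by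
  refine ⟨h.1.congr hf, h.2.1.congr hg, fun φ hφ hc => ?_⟩
  have e1 : ∫ x, f' x * iteratedDeriv l φ x = ∫ x, f x * iteratedDeriv l φ x :=
    integral_congr_ae (hf.mono fun x hx => by simp only [hx])
  have e2 : ∫ x, g' x * φ x = ∫ x, g x * φ x :=
    integral_congr_ae (hg.mono fun x hx => by simp only [hx])
  rw [e1, e2]
  exact h.2.2 φ hφ hc

theorem HasWeakDeriv.sub {l : ℕ} {f f' g g' : ℝ → ℝ} (h : HasWeakDeriv l f g)
    (h' : HasWeakDeriv l f' g') : HasWeakDeriv l (fun x => f x - f' x) (fun x => g x - g' x) := by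
  refine ⟨h.1.sub h'.1, h.2.1.sub h'.2.1, fun φ hφ hc => ?_⟩
  have c1 := (contDiff_iteratedDeriv_infty hφ l).continuous
  have c2 := iteratedDeriv_compactSupport hc l
  simp only [sub_mul]
  rw [integral_sub (integrable_mul_test h.1 c1 c2)
      (integrable_mul_test h'.1 c1 c2),
    integral_sub (integrable_mul_test h.2.1 hφ.continuous hc)
      (integrable_mul_test h'.2.1 hφ.continuous hc), h.2.2 φ hφ hc,
    h'.2.2 φ hφ hc, mul_sub]

theorem HasWeakDeriv.const_mul {l : ℕ} {f g : ℝ → ℝ} (h : HasWeakDeriv l f g) (c : ℝ) :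
    HasWeakDeriv l (fun x => c * f x) (fun x => c * g x) := by
  refine ⟨h.1.smul c, h.2.1.smul c, fun φ hφ hc => ?_⟩
  simp only [mul_assoc]
  rw [integral_const_mul, integral_const_mul, h.2.2 φ hφ hc]
  ring

theorem HasWeakDeriv.step {l : ℕ} {f g g' : ℝ → ℝ} (h : HasWeakDeriv l f g)
    (h' : HasWeakDeriv (l + 1) f g') : HasWeakDeriv 1 g g' := by
  refine ⟨h.2.1, h'.2.1, fun φ hφ hc => ?_⟩
  have e := h.2.2 (deriv φ) (by simpa using contDiff_iteratedDeriv_infty hφ 1) hc.deriv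
  have e' := h'.2.2 φ hφ hc
  rw [iteratedDeriv_succ'] at e'
  rw [e', pow_succ, mul_assoc] at e
  have := mul_left_cancel₀ (pow_ne_zero l (by norm_num : (-1 : ℝ) ≠ 0)) e
  simpa using this.symm

theorem HasWeakDeriv.of_deriv {l : ℕ} {f g h : ℝ → ℝ} (hfg : HasWeakDeriv 1 f g)
    (hgh : HasWeakDeriv l g h) : HasWeakDeriv (l + 1) f h := by
  refine ⟨hfg.1, hgh.2.1, fun φ hφ hc => ?_⟩
  have e := hfg.2.2 _ (contDiff_iteratedDeriv_infty hφ l) (iteratedDeriv_compactSupport hc l)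
  rw [iteratedDeriv_one, ← iteratedDeriv_succ, hgh.2.2 φ hφ hc] at e
  rw [e]; ring

/-! ### Absolutely continuous primitives -/

/-- The primitive of a locally integrable function is absolutely continuous with derivative `h`
almost everywhere, so the product rule with a C¹ factor integrates. -/
theorem primitive_mul_sub {h φ φ' : ℝ → ℝ} (hh : LocallyIntegrable h) (c : ℝ)
    (hφ : ∀ x, HasDerivAt φ (φ' x) x) (hφ' : Continuous φ') (a b : ℝ) :
    ∫ x in a..b, ((c + ∫ y in (0 : ℝ)..x, h y) * φ' x + h x * φ x) =
      (c + ∫ y in (0 : ℝ)..b, h y) * φ b - (c + ∫ y in (0 : ℝ)..a, h y) * φ a := by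
  have hi := intervalIntegrable_of_locallyIntegrable hh
  have hd : deriv φ = φ' := funext fun x => (hφ x).deriv
  have hC : ContDiff ℝ 1 φ := contDiff_one_iff_deriv.2
    ⟨fun x => (hφ x).differentiableAt, by rwa [hd]⟩
  set g : ℝ → ℝ := fun x => c + ∫ y in (0 : ℝ)..x, h y with hg
  -- The primitive is based at 0, so absolute continuity is obtained on an interval containing 0 as
  -- well as `a` and `b`.
  set m := min 0 (min a b)
  set M := max 0 (max a b)
  have hmM : m ≤ M := (min_le_left _ _).trans (le_max_left _ _)
  have hgac : AbsolutelyContinuousOnInterval g a b := by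
    have h1 := ((hi m M).absolutelyContinuousOnInterval_intervalIntegral (c := 0)
      (by rw [uIcc_of_le hmM]; exact ⟨min_le_left _ _, le_max_left _ _⟩)).mono
      (show uIcc a b ⊆ uIcc m M by
        rw [uIcc_of_le hmM]
        exact Icc_subset_Icc (min_le_right _ _) (le_max_right _ _))
    have h2 : AbsolutelyContinuousOnInterval (fun _ : ℝ => c) a b :=
      (contDiff_const (n := 1)).contDiffOn.absolutelyContinuousOnInterval
    exact h2.add h1
  have hφac : AbsolutelyContinuousOnInterval φ a b :=
    hC.contDiffOn.absolutelyContinuousOnInterval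
  have key := AbsolutelyContinuousOnInterval.integral_deriv_mul_eq_sub hgac hφac
  rw [← key]
  apply intervalIntegral.integral_congr_ae
  filter_upwards [(hi m M).ae_hasDerivAt_integral] with x hx hxab
  have hx1 : x ∈ uIcc m M := by
    rw [uIcc_of_le hmM]
    have := uIoc_subset_uIcc hxab
    exact Icc_subset_Icc (min_le_right _ _) (le_max_right _ _) this
  have hgx : HasDerivAt g (h x) x := (hx hx1 0 (by
    rw [uIcc_of_le hmM]; exact ⟨min_le_left _ _, le_max_left _ _⟩)).const_add c
  rw [hgx.deriv, hd]; ring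

theorem integral_primitive_mul_deriv {h φ : ℝ → ℝ} (hh : LocallyIntegrable h) (c : ℝ)
    (hφ : ContDiff ℝ ∞ φ) (hc : HasCompactSupport φ) :
    ∫ x, (c + ∫ y in (0 : ℝ)..x, h y) * deriv φ x = -∫ x, h x * φ x := by
  have hgc : Continuous fun x => c + ∫ y in (0 : ℝ)..x, h y :=
    continuous_const.add (intervalIntegral.continuous_primitive (intervalIntegrable_of_locallyIntegrable hh) 0)
  have i1 := integrable_mul_test hgc.locallyIntegrable
    (hφ.continuous_deriv (by simp)) hc.deriv
  have i2 := integrable_mul_test hh hφ.continuous hc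
  rw [eq_neg_iff_add_eq_zero, ← integral_add i1 i2]
  have hφd : ∀ x, HasDerivAt φ (deriv φ x) x := fun x => ((hφ.differentiable (by simp)) x).hasDerivAt
  have ht := intervalIntegral_tendsto_integral (i1.add i2) tendsto_neg_atTop_atBot tendsto_id
  refine tendsto_nhds_unique ht ?_
  obtain ⟨R, hR⟩ := hc.isCompact.isBounded.subset_closedBall 0
  have hz : ∀ x, R < |x| → φ x = 0 := fun x hx => by
    by_contra hne
    have := hR (subset_tsupport φ hne)
    rw [mem_closedBall_zero_iff, Real.norm_eq_abs] at this
    linarith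
  refine tendsto_const_nhds.congr' ?_
  filter_upwards [eventually_gt_atTop R, eventually_gt_atTop 0] with x hx hx0
  have e := primitive_mul_sub hh c hφd (hφ.continuous_deriv (by simp)) (-x) x
  simp only [id, Pi.add_apply] at e ⊢
  rw [e, hz x (by rwa [abs_of_pos hx0]), hz (-x) (by rwa [abs_neg, abs_of_pos hx0])]
  simp

/-- The du Bois-Reymond lemma. A test function of integral zero is the derivative of a test
function, and subtracting (∫φ)ψ with ∫ψ = 1 makes any φ of this kind; the constant is therefore ∫fψ.
-/
theorem ae_eq_const_of_integral_mul_deriv_eq_zero {f : ℝ → ℝ} (hf : LocallyIntegrable f)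
    (h : ∀ φ : ℝ → ℝ, ContDiff ℝ ∞ φ → HasCompactSupport φ → ∫ x, f x * deriv φ x = 0) :
    ∃ c : ℝ, f =ᵐ[volume] fun _ => c := by
  obtain ⟨ψ, hψc, hψ, hψ1⟩ : ∃ ψ : ℝ → ℝ, HasCompactSupport ψ ∧ ContDiff ℝ ∞ ψ ∧ ∫ x, ψ x = 1 := by
    let b : ContDiffBump (0 : ℝ) := ⟨1, 2, by norm_num, by norm_num⟩
    exact ⟨b.normed volume, b.hasCompactSupport_normed, b.contDiff_normed, b.integral_normed⟩
  refine ⟨∫ x, f x * ψ x, ?_⟩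
  refine ae_eq_of_integral_contDiff_smul_eq hf continuous_const.locallyIntegrable ?_
  intro φ hφ hc
  set m := ∫ x, φ x with hm
  have hφi : Integrable φ := hφ.continuous.integrable_of_hasCompactSupport hc
  have hψi : Integrable ψ := hψ.continuous.integrable_of_hasCompactSupport hψc
  set η : ℝ → ℝ := fun x => φ x - m * ψ x with hη
  have hηs : ContDiff ℝ ∞ η := hφ.sub (contDiff_const.mul hψ)
  have hηi : Integrable η := hφi.sub (hψi.const_mul m)
  have hη0 : ∫ x, η x = 0 := by
    rw [hη, integral_sub hφi (hψi.const_mul m), integral_const_mul, hψ1]; simp [hm]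
  have hηc : HasCompactSupport η := hc.sub hψc.mul_left
  obtain ⟨R, hR⟩ := hηc.isCompact.isBounded.subset_closedBall 0
  have hz : ∀ x, R < |x| → η x = 0 := fun x hx => by
    by_contra hne
    have := hR (subset_tsupport η hne)
    rw [mem_closedBall_zero_iff, Real.norm_eq_abs] at this
    linarith
  -- The base point lies to the left of the support of `η`, so `Φ` vanishes there; it vanishes on
  -- the far right because ∫η = 0.
  set Φ : ℝ → ℝ := fun x => ∫ y in (-(|R| + 1))..x, η y with hΦ
  have hΦd : ∀ x, HasDerivAt Φ (η x) x := fun x =>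
    intervalIntegral.integral_hasDerivAt_right (hηs.continuous.intervalIntegrable _ _)
      (hηs.continuous.stronglyMeasurableAtFilter _ _) hηs.continuous.continuousAt
  have hΦ' : deriv Φ = η := funext fun x => (hΦd x).deriv
  have hΦs : ContDiff ℝ ∞ Φ := by
    rw [contDiff_infty_iff_deriv]
    exact ⟨fun x => (hΦd x).differentiableAt, by rwa [hΦ']⟩
  have hRR := le_abs_self R
  have hΦc : HasCompactSupport Φ := by
    refine HasCompactSupport.intro (isCompact_Icc (a := -(|R| + 1)) (b := |R| + 1)) fun x hx => ?_
    rw [mem_Icc, not_and_or, not_le, not_le] at hx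
    rcases hx with hx | hx
    · refine intervalIntegral.integral_zero_ae (ae_of_all _ fun y hy => hz y ?_)
      rw [uIoc_of_ge hx.le] at hy
      have := neg_le_abs y
      have := hy.2
      linarith
    · have e : Φ x = ∫ y, η y := by
        rw [hΦ]
        simp only
        rw [intervalIntegral.integral_of_le (by have := abs_nonneg R; linarith)]
        refine setIntegral_eq_integral_of_forall_compl_eq_zero fun y hy => hz y ?_
        rw [mem_Ioc, not_and_or, not_lt, not_le] at hy
        rcases hy with hy | hy
        · have := neg_le_abs y; linarith
        · have := le_abs_self y; linarith
      rw [e, hη0]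
  have e := h Φ hΦs hΦc
  rw [hΦ', hη] at e
  have i1 := integrable_mul_test hf hφ.continuous hc
  have i2 := integrable_mul_test hf hψ.continuous hψc
  have : (fun x => f x * (φ x - m * ψ x)) = fun x => f x * φ x - m * (f x * ψ x) := by
    ext x; ring
  rw [this, integral_sub i1 (i2.const_mul m), integral_const_mul, sub_eq_zero] at e
  simp only [smul_eq_mul]
  rw [integral_mul_const, ← hm, ← e]
  simp only [mul_comm]

theorem HasWeakDeriv.exists_primitive {f g : ℝ → ℝ} (h : HasWeakDeriv 1 f g) :
    ∃ c : ℝ, f =ᵐ[volume] fun x => c + ∫ y in (0 : ℝ)..x, g y := by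
  have hgc : Continuous fun x => ∫ y in (0 : ℝ)..x, g y :=
    intervalIntegral.continuous_primitive (intervalIntegrable_of_locallyIntegrable h.2.1) 0
  obtain ⟨c, hc⟩ := ae_eq_const_of_integral_mul_deriv_eq_zero
    (h.1.sub hgc.locallyIntegrable) (fun φ hφ hc => by
      have e := h.2.2 φ hφ hc
      have e' := integral_primitive_mul_deriv h.2.1 0 hφ hc
      simp only [zero_add] at e'
      have i1 := integrable_mul_test h.1 (hφ.continuous_deriv (by simp)) hc.deriv
      have i2 := integrable_mul_test hgc.locallyIntegrable
        (hφ.continuous_deriv (by simp)) hc.deriv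
      simp only [Pi.sub_apply, sub_mul]
      rw [integral_sub i1 i2, e']
      simp only [iteratedDeriv_one] at e
      rw [e]; ring)
  refine ⟨c, hc.mono fun x hx => ?_⟩
  simp only [Pi.sub_apply] at hx
  linarith

theorem HasWeakDeriv.eq_primitive {f g : ℝ → ℝ} (h : HasWeakDeriv 1 f g) (hf : Continuous f) :
    ∃ c : ℝ, ∀ x, f x = c + ∫ y in (0 : ℝ)..x, g y := by
  obtain ⟨c, hc⟩ := h.exists_primitive
  have hgc : Continuous fun x => c + ∫ y in (0 : ℝ)..x, g y :=
    continuous_const.add (intervalIntegral.continuous_primitive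
      (intervalIntegrable_of_locallyIntegrable h.2.1) 0)
  exact ⟨c, congrFun ((Continuous.ae_eq_iff_eq volume hf hgc).1 hc)⟩

theorem HasWeakDeriv.hasDerivAt {f g : ℝ → ℝ} (h : HasWeakDeriv 1 f g) (hf : Continuous f)
    (hg : Continuous g) (x : ℝ) : HasDerivAt f (g x) x := by
  obtain ⟨c, hc⟩ := h.eq_primitive hf
  rw [funext hc]
  exact (intervalIntegral.integral_hasDerivAt_right (hg.intervalIntegrable _ _)
      (hg.stronglyMeasurableAtFilter _ _) hg.continuousAt).const_add c

/-- `f` is of class `C^k` and its classical derivatives of order at most `k` lie in `L²`. -/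
def Sob (k : ℕ) (f : ℝ → ℝ) : Prop :=
  ContDiff ℝ k f ∧ ∀ l ≤ k, MemLp (iteratedDeriv l f) 2

/-- The weak derivative of order l ≤ k agrees almost everywhere with a continuous primitive `G l` of
the next one, and these primitives are classical derivatives of one another. Passing to continuous
representatives costs one order. -/
theorem MemH.sob {k : ℕ} {f : ℝ → ℝ} (h : MemH (k + 1) f) (hf : Continuous f) : Sob k f := by
  choose! g hg hgL using h
  have hstep : ∀ l ≤ k, HasWeakDeriv 1 (g l) (g (l + 1)) := fun l hl =>
    (hg l (by lia)).step (hg (l + 1) (by lia))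
  choose! c hc using fun l (hl : l ≤ k) => (hstep l hl).exists_primitive
  set G : ℕ → ℝ → ℝ := fun l x => c l + ∫ y in (0 : ℝ)..x, g (l + 1) y with hG
  have hGc : ∀ l ≤ k, Continuous (G l) := fun l hl =>
    continuous_const.add (intervalIntegral.continuous_primitive
      (intervalIntegrable_of_locallyIntegrable (hstep l hl).2.1) 0)
  have hG0 : G 0 = f := by
    have h0 : HasWeakDeriv 0 f f := by
      simpa using hasWeakDeriv_iteratedDeriv (l := 0) (f := f) (contDiff_zero.2 hf)
    have := (hc 0 (by lia)).symm.trans ((hg 0 (by lia)).ae_eq h0)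
    exact (Continuous.ae_eq_iff_eq volume (hGc 0 (by lia)) hf).1 this
  have hGd : ∀ l < k, ∀ x, HasDerivAt (G l) (G (l + 1) x) x := fun l hl x =>
    ((hstep l hl.le).congr_ae (hc l hl.le) (hc (l + 1) hl)).hasDerivAt (hGc l hl.le)
      (hGc (l + 1) hl) x
  have hit : ∀ l ≤ k, iteratedDeriv l f = G l := by
    intro l
    induction l with
    | zero => intro _; simp [hG0]
    | succ l ih =>
      intro hl
      rw [iteratedDeriv_succ, ih (by lia)]
      exact funext fun x => (hGd l hl x).deriv
  refine ⟨contDiff_nat_iff_iteratedDeriv.2 ⟨fun m hm => ?_, fun m hm => ?_⟩, fun l hl => ?_⟩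
  · rw [hit m hm]; exact hGc m hm
  · rw [hit m hm.le]; exact fun x => (hGd m hm x).differentiableAt
  · rw [hit l hl]; exact (hgL l (by lia)).ae_eq (hc l hl)

/-- Integration by parts for a weak derivative against a `C¹` function. -/
theorem HasWeakDeriv.integral_mul_deriv {g h φ φ' : ℝ → ℝ} (hw : HasWeakDeriv 1 g h)
    (hg : Continuous g) (hφ : ∀ x, HasDerivAt φ (φ' x) x) (hφ' : Continuous φ')
    (i0 : Integrable fun x => g x * φ x) (i1 : Integrable fun x => g x * φ' x)
    (i2 : Integrable fun x => h x * φ x) :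
    ∫ x, g x * φ' x = -∫ x, h x * φ x := by
  obtain ⟨c, hc⟩ := hw.eq_primitive hg
  rw [eq_neg_iff_add_eq_zero, ← integral_add i1 i2]
  set P : ℝ → ℝ := fun x => g x * φ' x + h x * φ x with hP
  have hPi : Integrable P := i1.add i2
  have key : ∀ a b, ∫ x in a..b, P x = g b * φ b - g a * φ a := fun a b => by
    have := primitive_mul_sub hw.2.1 c hφ hφ' a b
    simpa only [← hc] using this
  have e1 : Tendsto (fun b => g b * φ b) atTop (𝓝 (g 0 * φ 0 + ∫ x in Ioi 0, P x)) := by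
    have := (intervalIntegral_tendsto_integral_Ioi 0 hPi.integrableOn tendsto_id).const_add
      (g 0 * φ 0)
    refine this.congr fun b => ?_
    rw [key]; simp
  have e2 : Tendsto (fun b => g b * φ b) atBot (𝓝 (g 0 * φ 0 - ∫ x in Iic 0, P x)) := by
    have := (intervalIntegral_tendsto_integral_Iic 0 hPi.integrableOn tendsto_id).const_sub
      (g 0 * φ 0)
    refine this.congr fun b => ?_
    rw [key]; simp
  -- The product g·φ has a limit at infinity because its derivative `P` is integrable; being
  -- integrable itself, it can only tend to 0.
  have z1 : g 0 * φ 0 + ∫ x in Ioi 0, P x = 0 := by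
    refine IntegrableAtFilter.eq_zero_of_tendsto (l := atTop) (μ := volume)
      ⟨univ, univ_mem, i0.integrableOn⟩ (fun s hs => ?_) e1
    rcases mem_atTop_sets.1 hs with ⟨b, hb⟩
    rw [← top_le_iff, ← Real.volume_Ici (a := b)]
    exact measure_mono hb
  have z2 : g 0 * φ 0 - ∫ x in Iic 0, P x = 0 := by
    refine IntegrableAtFilter.eq_zero_of_tendsto (l := atBot) (μ := volume)
      ⟨univ, univ_mem, i0.integrableOn⟩ (fun s hs => ?_) e2
    rcases mem_atBot_sets.1 hs with ⟨b, hb⟩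
    rw [← top_le_iff, ← Real.volume_Iic (a := b)]
    exact measure_mono hb
  have := intervalIntegral.integral_Iic_add_Ioi (f := P) (b := 0) hPi.integrableOn hPi.integrableOn
  rw [← this]
  linarith

/-! ### Extension of `C^n` functions from a compact interval -/

/-- Extend the top derivative by constants and integrate back. A one-point interval is treated
apart, since derivatives within it are not unique. -/
theorem exists_contDiff_eqOn_Icc (n : ℕ) {a b : ℝ} (hab : a ≤ b) {f : ℝ → ℝ}
    (hf : ContDiffOn ℝ n f (Icc a b)) : ∃ g : ℝ → ℝ, ContDiff ℝ n g ∧ EqOn g f (Icc a b) := by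
  rcases hab.eq_or_lt with rfl | hlt
  · refine ⟨fun _ => f a, contDiff_const, fun x hx => ?_⟩
    rw [Icc_self, mem_singleton_iff] at hx
    rw [hx]
  induction n generalizing f with
  | zero =>
    refine ⟨IccExtend hab ((Icc a b).domRestrict f), ?_, fun x hx => ?_⟩
    · exact contDiff_zero.2 (hf.continuousOn.domRestrict.Icc_extend' )
    · rw [IccExtend_of_mem _ _ hx, domRestrict_apply]
  | succ n ih =>
    have hu := uniqueDiffOn_Icc hlt
    have h1 := (contDiffOn_succ_iff_derivWithin (n := (n : ℕ∞ω)) hu).1 (by exact_mod_cast hf)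
    obtain ⟨g, hg, hgf⟩ := ih h1.2.2
    set F : ℝ → ℝ := fun x => f a + ∫ y in a..x, g y with hF
    have hFd : ∀ x, HasDerivAt F (g x) x := fun x =>
      (intervalIntegral.integral_hasDerivAt_right (hg.continuous.intervalIntegrable _ _)
        (hg.continuous.stronglyMeasurableAtFilter _ _) hg.continuous.continuousAt).const_add _
    have hF' : deriv F = g := funext fun x => (hFd x).deriv
    refine ⟨F, ?_, ?_⟩
    · have : ContDiff ℝ ((n : ℕ∞ω) + 1) F := contDiff_succ_iff_deriv.2
        ⟨fun x => (hFd x).differentiableAt, by simp, by rwa [hF']⟩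
      exact_mod_cast this
    · refine eq_of_derivWithin_eq (fun x _ => (hFd x).differentiableAt.differentiableWithinAt) h1.1
        (fun x hx => ?_) (by simp [hF])
      rw [(hFd x).hasDerivWithinAt.derivWithin (hu x (Ico_subset_Icc_self hx)),
        hgf (Ico_subset_Icc_self hx)]

/-! ### Sobolev embedding and interpolation on the line -/

theorem integrable_mul_of_memLp {f g : ℝ → ℝ} (hf : MemLp f 2) (hg : MemLp g 2) :
    Integrable fun x => f x * g x := hf.integrable_mul hg

/-- Since f² and its derivative are integrable, f² vanishes at -∞, so f(x)² is the integral of 2ff'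
≤ f² + f'² over (-∞, x]. -/
theorem sq_le_integral_sq_add {f f' : ℝ → ℝ} (hd : ∀ x, HasDerivAt f (f' x) x) (hf : MemLp f 2)
    (hf' : MemLp f' 2) (x : ℝ) : f x ^ 2 ≤ (∫ y, f y ^ 2) + ∫ y, f' y ^ 2 := by
  have hd2 : ∀ y, HasDerivAt (fun y => f y ^ 2) (2 * (f y * f' y)) y := fun y => by
    convert! (hd y).pow 2 using 1; push_cast; ring
  have i1 : Integrable fun y => 2 * (f y * f' y) := (integrable_mul_of_memLp hf hf').const_mul 2
  have i2 := hf.integrable_sq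
  have i3 := hf'.integrable_sq
  have ht := tendsto_zero_of_hasDerivAt_of_integrableOn_Iic (a := x) (fun y _ => hd2 y)
    i1.integrableOn i2.integrableOn
  have e := integral_Iic_of_hasDerivAt_of_tendsto' (a := x) (fun y _ => hd2 y) i1.integrableOn ht
  rw [sub_zero] at e
  rw [← e, ← integral_add i2 i3]
  refine (setIntegral_mono i1.integrableOn (i2.add i3).integrableOn fun y => ?_).trans
    (setIntegral_le_integral (i2.add i3) (ae_of_all _ fun y => ?_))
  · simp only [Pi.add_apply]; nlinarith [sq_nonneg (f y - f' y)]
  · simp only [Pi.add_apply, Pi.zero_apply]; positivity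

theorem integrable_of_abs_le {f g : ℝ → ℝ} (hf : Continuous f) (hg : Integrable g)
    (h : ∀ x, |f x| ≤ g x) : Integrable f :=
  hg.mono' hf.aestronglyMeasurable (ae_of_all _ h)

theorem abs_rpow_le {x B q : ℝ} (hq : 2 ≤ q) (hx : |x| ≤ B) : |x| ^ q ≤ B ^ (q - 2) * x ^ 2 := by
  have : |x| ^ q = |x| ^ (q - 2) * |x| ^ (2 : ℝ) := by
    rw [← Real.rpow_add_of_nonneg (abs_nonneg x) (by linarith) (by norm_num)]; congr 1; ring
  rw [this, Real.rpow_two, sq_abs]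
  have := Real.rpow_le_rpow (abs_nonneg x) hx (by linarith : 0 ≤ q - 2)
  gcongr

theorem integrable_abs_rpow {f : ℝ → ℝ} {B q : ℝ} (hq : 2 ≤ q) (hf : MemLp f 2)
    (hc : Continuous f) (hB : ∀ x, |f x| ≤ B) : Integrable fun x => |f x| ^ q := by
  refine integrable_of_abs_le (hc.abs.rpow_const fun x => Or.inr (by linarith))
    (hf.integrable_sq.const_mul (B ^ (q - 2))) fun x => ?_
  rw [abs_of_nonneg (by positivity)]
  exact abs_rpow_le hq (hB x)

theorem hasDerivAt_abs_rpow_mul {q : ℝ} (hq : 2 ≤ q) (y : ℝ) :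
    HasDerivAt (fun y : ℝ => |y| ^ (q - 2) * y) ((q - 1) * |y| ^ (q - 2)) y := by
  rcases hq.eq_or_lt with rfl | hq
  · simp only [sub_self, Real.rpow_zero, one_mul, mul_one]
    convert! hasDerivAt_id y using 1; norm_num
  rcases eq_or_ne y 0 with rfl | hy
  · have h0 : (q - 1) * |(0 : ℝ)| ^ (q - 2) = 0 := by
      rw [abs_zero, Real.zero_rpow (by linarith), mul_zero]
    rw [h0, hasDerivAt_iff_tendsto_slope]
    have : Tendsto (fun y : ℝ => |y| ^ (q - 2)) (𝓝[≠] 0) (𝓝 0) := by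
      have c : Continuous fun y : ℝ => |y| ^ (q - 2) :=
        continuous_abs.rpow_const fun x => Or.inr (by linarith)
      have := c.tendsto 0
      rw [abs_zero, Real.zero_rpow (by linarith)] at this
      exact this.mono_left nhdsWithin_le_nhds
    refine this.congr' ?_
    filter_upwards [self_mem_nhdsWithin] with y hy
    have hy : y ≠ 0 := hy
    rw [slope_def_field]; field_simp; simp
  · have h1 : HasDerivAt (fun y : ℝ => |y| ^ (q - 2)) _ y :=
      (hasDerivAt_abs hy).rpow_const (p := q - 2) (Or.inl (abs_ne_zero.2 hy))
    convert! h1.mul (hasDerivAt_id y) using 1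
    have e : |y| ^ (q - 2) = |y| ^ (q - 2 - 1) * |y| := by
      rw [← Real.rpow_add_one (abs_ne_zero.2 hy)]; congr 1; ring
    have : (SignType.sign y : ℝ) * y = |y| := sign_mul_self y
    simp only [id]
    rw [e]
    linear_combination (-(q - 2) * |y| ^ (q - 2 - 1)) * this

/-- The derivative of f|f'|^(q-2)f' has integral zero, which trades |f'|^q for -(q-1)f|f'|^(q-2)f''.
The bound `B` serves integrability only and does not enter the estimate. -/
theorem integral_abs_deriv_rpow_le {f f' f'' : ℝ → ℝ} {q B : ℝ} (hq : 2 ≤ q)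
    (hf : ∀ x, HasDerivAt f (f' x) x) (hf' : ∀ x, HasDerivAt f' (f'' x) x) (hc : Continuous f'')
    (m0 : MemLp f 2) (m1 : MemLp f' 2) (m2 : MemLp f'' 2) (hB : ∀ x, |f' x| ≤ B) :
    Integrable (fun x => |f x| * |f' x| ^ (q - 2) * |f'' x|) ∧
    ∫ x, |f' x| ^ q ≤ ∫ x, (q - 1) * (|f x| * |f' x| ^ (q - 2) * |f'' x|) := by
  have c0 : Continuous f := continuous_iff_continuousAt.2 fun x => (hf x).continuousAt
  have c1 : Continuous f' := continuous_iff_continuousAt.2 fun x => (hf' x).continuousAt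
  have cr : Continuous fun x => |f' x| ^ (q - 2) :=
    c1.abs.rpow_const fun x => Or.inr (by linarith)
  have hr : ∀ x, |f' x| ^ (q - 2) ≤ B ^ (q - 2) := fun x =>
    Real.rpow_le_rpow (abs_nonneg _) (hB x) (by linarith)
  have hr0 : ∀ x, 0 ≤ |f' x| ^ (q - 2) := fun x => by positivity
  have iA : Integrable (fun x => |f x| * |f' x| ^ (q - 2) * |f'' x|) := by
    refine integrable_of_abs_le ((c0.abs.mul cr).mul hc.abs)
      ((integrable_mul_of_memLp m0 m2).abs.const_mul (B ^ (q - 2))) fun x => ?_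
    rw [abs_of_nonneg (by positivity), abs_mul]
    calc _ = |f' x| ^ (q - 2) * (|f x| * |f'' x|) := by ring
      _ ≤ _ := mul_le_mul_of_nonneg_right (hr x) (by positivity)
  have iB : Integrable (fun x => f x * ((q - 1) * |f' x| ^ (q - 2) * f'' x)) := by
    refine integrable_of_abs_le (c0.mul ((continuous_const.mul cr).mul hc))
      (iA.const_mul (q - 1)) fun x => ?_
    rw [abs_mul, abs_mul, abs_mul, abs_of_nonneg (by linarith : 0 ≤ q - 1),
      abs_of_nonneg (hr0 x)]
    exact le_of_eq (by ring)
  have iC : Integrable (fun x => f x * (|f' x| ^ (q - 2) * f' x)) := by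
    refine integrable_of_abs_le (c0.mul (cr.mul c1))
      ((integrable_mul_of_memLp m0 m1).abs.const_mul (B ^ (q - 2))) fun x => ?_
    rw [abs_mul, abs_mul, abs_mul, abs_of_nonneg (hr0 x)]
    calc _ = |f' x| ^ (q - 2) * (|f x| * |f' x|) := by ring
      _ ≤ _ := mul_le_mul_of_nonneg_right (hr x) (by positivity)
  have iq := integrable_abs_rpow hq m1 c1 hB
  have epow : ∀ x, f' x * (|f' x| ^ (q - 2) * f' x) = |f' x| ^ q := fun x => by
    have : |f' x| ^ q = |f' x| ^ (q - 2) * |f' x| ^ (2 : ℝ) := by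
      rw [← Real.rpow_add_of_nonneg (abs_nonneg _) (by linarith) (by norm_num)]; congr 1; ring
    rw [this, Real.rpow_two, sq_abs]; ring
  refine ⟨iA, ?_⟩
  have hd : ∀ x, HasDerivAt (fun x => f x * (|f' x| ^ (q - 2) * f' x))
      (|f' x| ^ q + f x * ((q - 1) * |f' x| ^ (q - 2) * f'' x)) x := fun x => by
    rw [← epow x]
    exact (hf x).mul ((hasDerivAt_abs_rpow_mul hq (f' x)).comp x (hf' x))
  have e := integral_eq_zero_of_hasDerivAt_of_integrable hd (iq.add iB) iC
  rw [integral_add iq iB] at e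
  rw [eq_neg_of_add_eq_zero_left e, ← integral_neg]
  refine integral_mono iB.neg (iA.const_mul _) fun x => ?_
  have h1 := neg_abs_le (f x * ((q - 1) * |f' x| ^ (q - 2) * f'' x))
  rw [abs_mul, abs_mul, abs_mul, abs_of_nonneg (by linarith : 0 ≤ q - 1),
      abs_of_nonneg (hr0 x)] at h1
  simp only
  linarith

/-- Weighted AM–GM for εX, εY, CZ, with `C` chosen so that the geometric mean carries exactly the
factor `K`. Only `w₃` has to be positive; a vanishing `w₁` is used at the start of the interpolation
chain. -/
theorem exists_young_three {w₁ w₂ w₃ : ℝ} (h₁ : 0 ≤ w₁) (h₂ : 0 ≤ w₂) (h₃ : 0 < w₃)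
    (hw : w₁ + w₂ + w₃ = 1) {ε K : ℝ} (hε : 0 < ε) (hK : 0 ≤ K) :
    ∃ C : ℝ, 0 ≤ C ∧ ∀ X Y Z : ℝ, 0 ≤ X → 0 ≤ Y → 0 ≤ Z →
      K * (X ^ w₁ * Y ^ w₂ * Z ^ w₃) ≤ ε * X + ε * Y + C * Z := by
  set C : ℝ := (K / (ε ^ w₁ * ε ^ w₂)) ^ (1 / w₃) with hC
  have hC0 : 0 ≤ C := by positivity
  refine ⟨C, hC0, fun X Y Z hX hY hZ => ?_⟩
  have h := Real.geom_mean_le_arith_mean3_weighted h₁ h₂ h₃.le (by positivity : 0 ≤ ε * X)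
    (by positivity : 0 ≤ ε * Y) (by positivity : 0 ≤ C * Z) hw
  rw [Real.mul_rpow hε.le hX, Real.mul_rpow hε.le hY, Real.mul_rpow hC0 hZ] at h
  have hCw : C ^ w₃ = K / (ε ^ w₁ * ε ^ w₂) := by
    rw [hC, ← Real.rpow_mul (by positivity), one_div, inv_mul_cancel₀ h₃.ne', Real.rpow_one]
  rw [hCw] at h
  have hpos : 0 < ε ^ w₁ * ε ^ w₂ := by positivity
  have e : ε ^ w₁ * X ^ w₁ * (ε ^ w₂ * Y ^ w₂) * (K / (ε ^ w₁ * ε ^ w₂) * Z ^ w₃) =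
      K * (X ^ w₁ * Y ^ w₂ * Z ^ w₃) := by field_simp
  rw [e] at h
  have a1 : w₁ * (ε * X) ≤ 1 * (ε * X) := by gcongr; linarith
  have a2 : w₂ * (ε * Y) ≤ 1 * (ε * Y) := by gcongr; linarith
  have a3 : w₃ * (C * Z) ≤ 1 * (C * Z) := by gcongr; linarith
  linarith

theorem Sob.memLp {k l : ℕ} {f : ℝ → ℝ} (h : Sob k f) (hl : l ≤ k) :
    MemLp (iteratedDeriv l f) 2 := h.2 l hl

theorem Sob.hasDerivAt {k l : ℕ} {f : ℝ → ℝ} (h : Sob k f) (hl : l < k) (x : ℝ) :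
    HasDerivAt (iteratedDeriv l f) (iteratedDeriv (l + 1) f x) x :=
  hasDerivAt_iteratedDeriv h.1 hl x

theorem Sob.continuous {k l : ℕ} {f : ℝ → ℝ} (h : Sob k f) (hl : l ≤ k) :
    Continuous (iteratedDeriv l f) := h.1.continuous_iteratedDeriv l (by exact_mod_cast hl)

theorem Sob.sq_le {k l : ℕ} {f : ℝ → ℝ} (h : Sob k f) (hl : l < k) (x : ℝ) :
    iteratedDeriv l f x ^ 2 ≤
      (∫ y, iteratedDeriv l f y ^ 2) + ∫ y, iteratedDeriv (l + 1) f y ^ 2 :=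
  sq_le_integral_sq_add (h.hasDerivAt hl) (h.memLp hl.le) (h.memLp hl) x

theorem Sob.exists_bound {k l : ℕ} {f : ℝ → ℝ} (h : Sob k f) (hl : l < k) :
    ∃ B : ℝ, ∀ x, |iteratedDeriv l f x| ≤ B :=
  ⟨_, fun x => Real.abs_le_sqrt (h.sq_le hl x)⟩

/-- One step of the Gagliardo–Nirenberg chain. -/
theorem exists_interpolation_step (e : ℕ) (M : ℝ) (hM : 0 ≤ M) (j : ℕ) (hj1 : 1 ≤ j) (hje : j < e) :
    ∃ C : ℝ, 0 ≤ C ∧ ∀ W : ℝ → ℝ, Sob (e + 1) W → (∀ x, |W x| ≤ M) →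
      ∫ x, |iteratedDeriv j W x| ^ (2 * e / j : ℝ) ≤
        C * ∫ x, |iteratedDeriv (j + 1) W x| ^ (2 * e / (j + 1 : ℕ) : ℝ) := by
  have int : ∀ i, 1 ≤ i → i ≤ e → ∀ W : ℝ → ℝ, Sob (e + 1) W →
      Integrable fun x => |iteratedDeriv i W x| ^ (2 * e / i : ℝ) := by
    intro i hi hie W hW
    obtain ⟨B, hB⟩ := hW.exists_bound (l := i) (by lia)
    refine integrable_abs_rpow ?_ (hW.memLp (by lia)) (hW.continuous (by lia)) hB
    have : (0 : ℝ) < i := by exact_mod_cast hi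
    have : (i : ℝ) ≤ e := by exact_mod_cast hie
    rw [le_div_iff₀ (by positivity)]; linarith
  induction j, hj1 using Nat.le_induction with
  | base =>
    -- For j = 1 the undifferentiated factor is `W` itself, bounded by `M`, so Young's inequality is
    -- applied with two effective terms: w₁ = 0 and X = 0.
    have he : (2 : ℝ) ≤ e := by exact_mod_cast hje
    obtain ⟨C, hC, hY⟩ := exists_young_three (w₁ := 0) (w₂ := 1 - 1 / e) (w₃ := 1 / e) le_rfl
      (by rw [sub_nonneg, div_le_one (by positivity)]; linarith) (by positivity) (by ring)
      (ε := 1 / 2) (K := (2 * e - 1) * M) (by norm_num) (mul_nonneg (by linarith) hM)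
    refine ⟨2 * C, by positivity, fun W hW hWM => ?_⟩
    obtain ⟨B, hB⟩ := hW.exists_bound (l := 1) (by lia)
    obtain ⟨iA, hA⟩ := integral_abs_deriv_rpow_le (q := 2 * e) (by linarith)
      (f := W) (f' := iteratedDeriv 1 W) (f'' := iteratedDeriv 2 W) (B := B)
      (by simpa using hW.hasDerivAt (l := 0) (by lia)) (hW.hasDerivAt (l := 1) (by lia))
      (hW.continuous (by lia)) (by simpa using hW.memLp (l := 0) (by lia)) (hW.memLp (by lia))
      (hW.memLp (by lia)) hB
    have i1 := int 1 le_rfl (by lia) W hW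
    have i2 := int 2 (by lia) (by lia) W hW
    have hle := integral_mono (iA.const_mul (2 * (e : ℝ) - 1)) ((i1.const_mul (1 / 2)).add
      (i2.const_mul C)) (fun x => by
        have h := hY 0 (|iteratedDeriv 1 W x| ^ (2 * e / (1 : ℕ) : ℝ))
          (|iteratedDeriv 2 W x| ^ (2 * e / (2 : ℕ) : ℝ)) le_rfl (by positivity) (by positivity)
        rw [← Real.rpow_mul (abs_nonneg _), ← Real.rpow_mul (abs_nonneg _)] at h
        have e1 : (2 * e / (1 : ℕ) * (1 - 1 / e) : ℝ) = 2 * e - 2 := by push_cast; field_simp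
        have e2 : (2 * e / (2 : ℕ) * (1 / e) : ℝ) = 1 := by push_cast; field_simp
        rw [e1, e2, Real.rpow_zero, Real.rpow_one] at h
        simp only [Pi.add_apply]
        refine le_trans ?_ (h.trans (le_of_eq (by ring)))
        have : (0 : ℝ) ≤ 2 * e - 1 := by linarith
        have := hWM x
        calc _ ≤ (2 * (e : ℝ) - 1) * (M * |iteratedDeriv 1 W x| ^ (2 * e - 2 : ℝ) *
            |iteratedDeriv 2 W x|) := by gcongr
          _ = _ := by ring)
    simp only [Pi.add_apply] at hle
    rw [integral_add (i1.const_mul _) (i2.const_mul _), integral_const_mul (1 / 2 : ℝ),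
      integral_const_mul C] at hle
    have hA' := hA.trans hle
    simp only [Nat.cast_one, div_one, Nat.reduceAdd] at hA' ⊢
    linarith
  | succ j hj ih =>
    obtain ⟨C', hC', hI⟩ := ih (by lia)
    have hj0 : (1 : ℝ) ≤ j := by exact_mod_cast hj
    have hje' : (j : ℝ) + 1 + 1 ≤ e := by exact_mod_cast hje
    have hq : (2 : ℝ) ≤ 2 * e / (j + 1 : ℕ) := by
      push_cast; rw [le_div_iff₀ (by positivity)]; linarith
    have he : (0 : ℝ) < e := by linarith
    -- The induction hypothesis bounds the integral of order j by C' times that of order j+1; this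
    -- `ε` lets both ε-terms be absorbed on the left.
    set ε : ℝ := 1 / (4 * (C' + 1)) with hε
    have hε0 : 0 < ε := by positivity
    -- With q = 2e/(j+1), these exponents turn |∂ʲW|, |∂ʲ⁺¹W|^(q-2) and |∂ʲ⁺²W| into powers of the
    -- three integrands, and they add up to 1.
    obtain ⟨C, hC, hY⟩ := exists_young_three (w₁ := j / (2 * e)) (w₂ := 1 - (j + 1) / e)
      (w₃ := (j + 2) / (2 * e)) (by positivity)
      (by rw [sub_nonneg, div_le_one (by positivity)]; linarith) (by positivity)
      (by field_simp; ring)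
      (ε := ε) (K := 2 * e / (j + 1 : ℕ) - 1) hε0 (by linarith)
    refine ⟨2 * C, by positivity, fun W hW hWM => ?_⟩
    obtain ⟨B, hB⟩ := hW.exists_bound (l := j + 1) (by lia)
    obtain ⟨iA, hA⟩ := integral_abs_deriv_rpow_le (q := 2 * e / (j + 1 : ℕ)) hq
      (f := iteratedDeriv j W) (f' := iteratedDeriv (j + 1) W) (f'' := iteratedDeriv (j + 2) W)
      (B := B) (hW.hasDerivAt (by lia)) (hW.hasDerivAt (by lia))
      (hW.continuous (by lia)) (hW.memLp (by lia)) (hW.memLp (by lia))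
      (hW.memLp (by lia)) hB
    have i0 := int j hj (by lia) W hW
    have i1 := int (j + 1) (by lia) (by lia) W hW
    have i2 := int (j + 2) (by lia) (by lia) W hW
    have hle := integral_mono (iA.const_mul (2 * (e : ℝ) / (j + 1 : ℕ) - 1))
      (((i0.const_mul ε).add (i1.const_mul ε)).add (i2.const_mul C)) (fun x => by
        have h := hY (|iteratedDeriv j W x| ^ (2 * e / j : ℝ))
          (|iteratedDeriv (j + 1) W x| ^ (2 * e / (j + 1 : ℕ) : ℝ))
          (|iteratedDeriv (j + 2) W x| ^ (2 * e / (j + 2 : ℕ) : ℝ))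
          (by positivity) (by positivity) (by positivity)
        rw [← Real.rpow_mul (abs_nonneg _), ← Real.rpow_mul (abs_nonneg _),
          ← Real.rpow_mul (abs_nonneg _)] at h
        have e0 : (2 * e / j * (j / (2 * e)) : ℝ) = 1 := by field_simp
        have e1 : (2 * e / (j + 1 : ℕ) * (1 - (j + 1) / e) : ℝ) = 2 * e / (j + 1 : ℕ) - 2 := by
          push_cast; field_simp
        have e2 : (2 * e / (j + 2 : ℕ) * ((j + 2) / (2 * e)) : ℝ) = 1 := by
          push_cast; field_simp
        rw [e0, e1, e2, Real.rpow_one, Real.rpow_one] at h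
        exact h)
    simp only [Pi.add_apply] at hle
    have i01 : Integrable (fun x => ε * |iteratedDeriv j W x| ^ (2 * e / j : ℝ) +
        ε * |iteratedDeriv (j + 1) W x| ^ (2 * e / (j + 1 : ℕ) : ℝ)) :=
      (i0.const_mul ε).add (i1.const_mul ε)
    rw [integral_add i01 (i2.const_mul _), integral_add (i0.const_mul _) (i1.const_mul _), integral_const_mul ε,
      integral_const_mul ε, integral_const_mul C] at hle
    have hA' := hA.trans hle
    have h0 := hI W hW hWM
    have hp1 : 0 ≤ ∫ x, |iteratedDeriv (j + 1) W x| ^ (2 * e / (j + 1 : ℕ) : ℝ) :=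
      integral_nonneg fun x => by positivity
    have h0' := mul_le_mul_of_nonneg_left h0 hε0.le
    have hεC : ε * C' + ε ≤ 1 / 2 := by
      rw [hε]; field_simp; linarith
    have hfin := mul_le_mul_of_nonneg_right hεC hp1
    change _ ≤ 2 * C * ∫ x, |iteratedDeriv (j + 2) W x| ^ (2 * e / (j + 2 : ℕ) : ℝ)
    linarith

/-- Gagliardo–Nirenberg: intermediate derivatives are controlled by the highest one, in terms
of the supremum norm of the function. -/
theorem exists_interpolation (e : ℕ) (M : ℝ) (hM : 0 ≤ M) :
    ∃ C : ℝ, 0 ≤ C ∧ ∀ j, 1 ≤ j → j ≤ e → ∀ W : ℝ → ℝ, Sob (e + 1) W → (∀ x, |W x| ≤ M) →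
      Integrable (fun x => |iteratedDeriv j W x| ^ (2 * e / j : ℝ)) ∧
      ∫ x, |iteratedDeriv j W x| ^ (2 * e / j : ℝ) ≤ C * ∫ x, iteratedDeriv e W x ^ 2 := by
  have main : ∀ j, 1 ≤ j → j ≤ e → ∃ C : ℝ, 0 ≤ C ∧ ∀ W : ℝ → ℝ, Sob (e + 1) W →
      (∀ x, |W x| ≤ M) →
      ∫ x, |iteratedDeriv j W x| ^ (2 * e / j : ℝ) ≤ C * ∫ x, iteratedDeriv e W x ^ 2 := by
    intro j hj hje
    induction hje using Nat.decreasingInduction with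
    | self =>
      refine ⟨1, zero_le_one, fun W _ _ => ?_⟩
      have he : (e : ℝ) ≠ 0 := by exact_mod_cast (by lia : e ≠ 0)
      have : (2 * e / e : ℝ) = 2 := by field_simp
      simp only [this, Real.rpow_two, sq_abs, one_mul, le_refl]
    | of_succ j hje ih =>
      obtain ⟨C, hC, h⟩ := ih (by lia)
      obtain ⟨C', hC', h'⟩ := exists_interpolation_step e M hM j hj hje
      refine ⟨C' * C, by positivity, fun W hW hWM => (h' W hW hWM).trans ?_⟩
      rw [mul_assoc]
      exact mul_le_mul_of_nonneg_left (h W hW hWM) hC'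
  choose! C hC h using main
  refine ⟨∑ j ∈ Finset.Icc 1 e, C j, Finset.sum_nonneg fun j hj => ?_, fun j hj hje W hW hWM => ⟨?_, ?_⟩⟩
  · rw [Finset.mem_Icc] at hj; exact hC j hj.1 hj.2
  · obtain ⟨B, hB⟩ := hW.exists_bound (l := j) (by lia)
    refine integrable_abs_rpow ?_ (hW.memLp (by lia)) (hW.continuous (by lia)) hB
    have : (0 : ℝ) < j := by exact_mod_cast hj
    have : (j : ℝ) ≤ e := by exact_mod_cast hje
    rw [le_div_iff₀ (by positivity)]; linarith
  · refine (h j hj hje W hW hWM).trans (mul_le_mul_of_nonneg_right ?_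
      (integral_nonneg fun x => sq_nonneg _))
    exact Finset.single_le_sum (f := C) (fun i hi => by
      rw [Finset.mem_Icc] at hi; exact hC i hi.1 hi.2) (Finset.mem_Icc.2 ⟨hj, hje⟩)

/-! ### Differential polynomials -/

/-- The differential monomial `f(v) ∏_{j ∈ L} ∂ₓʲ v`. -/
noncomputable def diffMono (f : ℝ → ℝ) (L : List ℕ) (v : ℝ → ℝ) (x : ℝ) : ℝ :=
  f (v x) * (L.map fun j => iteratedDeriv j v x).prod

/-- Sums of monomials `f(v) ∏_{j ∈ L} ∂ₓʲ v` with `f` of class `C^r`, with at least one factor,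
factors of order between `1` and `q` and total order at most `n`. -/
inductive DiffPoly (r n q : ℕ) : ((ℝ → ℝ) → ℝ → ℝ) → Prop
  | mono {f : ℝ → ℝ} {L : List ℕ} (hf : ContDiff ℝ r f) (hL : L ≠ [])
      (hq : ∀ j ∈ L, 1 ≤ j ∧ j ≤ q) (hn : L.sum ≤ n) : DiffPoly r n q (diffMono f L)
  | zero : DiffPoly r n q (fun _ _ => 0)
  | add {Φ Ψ : (ℝ → ℝ) → ℝ → ℝ} (hΦ : DiffPoly r n q Φ) (hΨ : DiffPoly r n q Ψ) :
      DiffPoly r n q (fun v x => Φ v x + Ψ v x)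

theorem DiffPoly.weaken {r n q r' n' q' : ℕ} {Φ : (ℝ → ℝ) → ℝ → ℝ} (h : DiffPoly r n q Φ)
    (hr : r' ≤ r) (hn : n ≤ n') (hq : q ≤ q') : DiffPoly r' n' q' Φ := by
  induction h with
  | mono hf hL hq' hn' =>
    exact .mono (hf.of_le (by exact_mod_cast hr)) hL
      (fun j hj => ⟨(hq' j hj).1, (hq' j hj).2.trans hq⟩) (hn'.trans hn)
  | zero => exact .zero
  | add _ _ ih ih' => exact ih.add ih'

theorem DiffPoly.mul_iteratedDeriv {r n q j : ℕ} {Φ : (ℝ → ℝ) → ℝ → ℝ} (h : DiffPoly r n q Φ)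
    (hj : 1 ≤ j) (hjq : j ≤ q) :
    DiffPoly r (n + j) q (fun v x => Φ v x * iteratedDeriv j v x) := by
  induction h with
  | @mono f L hf hL hq hn =>
    have : (fun v x => diffMono f L v x * iteratedDeriv j v x) = diffMono f (j :: L) := by
      funext v x; simp only [diffMono, List.map_cons, List.prod_cons]; ring
    rw [this]
    refine .mono hf (by simp) (fun i hi => ?_) (by simp; lia)
    rcases List.mem_cons.1 hi with rfl | hi
    · exact ⟨hj, hjq⟩
    · exact hq i hi
  | zero => simpa using DiffPoly.zero
  | add _ _ ih ih' => simpa only [add_mul] using ih.add ih'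

theorem DiffPoly.congr {r n q : ℕ} {Φ Ψ : (ℝ → ℝ) → ℝ → ℝ} (h : DiffPoly r n q Φ)
    (e : ∀ v x, Φ v x = Ψ v x) : DiffPoly r n q Ψ := by
  rwa [← show Φ = Ψ from funext fun v => funext (e v)]

theorem DiffPoly.ofList {r n q : ℕ} {f : ℝ → ℝ} (L : List ℕ) (hf : ContDiff ℝ r f)
    (h : L ≠ [] ∧ (∀ j ∈ L, 1 ≤ j ∧ j ≤ q) ∧ L.sum ≤ n) {Φ : (ℝ → ℝ) → ℝ → ℝ}
    (e : ∀ v x, f (v x) * (L.map fun j => iteratedDeriv j v x).prod = Φ v x := by simp) :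
    DiffPoly r n q Φ :=
  (DiffPoly.mono hf h.1 h.2.1 h.2.2).congr e

theorem ContDiff.hasDerivAt_deriv {r : ℕ} {f : ℝ → ℝ} (hf : ContDiff ℝ (r + 1 : ℕ) f) (y : ℝ) :
    HasDerivAt f (deriv f y) y :=
  ((hf.differentiable (by simp)) y).hasDerivAt

theorem ContDiff.deriv_nat {r : ℕ} {f : ℝ → ℝ} (hf : ContDiff ℝ (r + 1 : ℕ) f) :
    ContDiff ℝ r (deriv f) :=
  (contDiff_succ_iff_deriv.1 (by exact_mod_cast hf)).2.2

theorem hasDerivAt_coeff {r q : ℕ} {f v : ℝ → ℝ} (hf : ContDiff ℝ (r + 1 : ℕ) f)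
    (hv : ContDiff ℝ (q + 1 : ℕ) v) (x : ℝ) :
    HasDerivAt (fun x => f (v x)) (deriv f (v x) * iteratedDeriv 1 v x) x := by
  have := hasDerivAt_iteratedDeriv hv (l := 0) (by lia) x
  rw [iteratedDeriv_zero] at this
  exact (ContDiff.hasDerivAt_deriv hf (v x)).comp x this

/-- The Leibniz rule, one factor peeled off at a time: total order and maximal order rise by one,
and the coefficient gives up one degree of smoothness. -/
theorem exists_deriv_diffMono {r q : ℕ} {f : ℝ → ℝ} (hf : ContDiff ℝ (r + 1 : ℕ) f) (L : List ℕ)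
    (hq : ∀ j ∈ L, 1 ≤ j ∧ j ≤ q) :
    ∃ Ψ, DiffPoly r (L.sum + 1) (q + 1) Ψ ∧ ∀ v, ContDiff ℝ (q + 1 : ℕ) v → ∀ x,
      HasDerivAt (diffMono f L v) (Ψ v x) x := by
  induction L with
  | nil =>
    refine ⟨fun v x => deriv f (v x) * iteratedDeriv 1 v x,
      .ofList [1] (ContDiff.deriv_nat hf) (by simp), fun v hv x => ?_⟩
    have e : diffMono f [] v = fun x => f (v x) := by funext x; simp [diffMono]
    rw [e]
    exact hasDerivAt_coeff hf hv x
  | cons j L ih =>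
    obtain ⟨Ψ, hΨ, hd⟩ := ih fun i hi => hq i (List.mem_cons_of_mem _ hi)
    have hj := hq j List.mem_cons_self
    refine ⟨fun v x => Ψ v x * iteratedDeriv j v x + diffMono f ((j + 1) :: L) v x,
      .add ((hΨ.mul_iteratedDeriv hj.1 (by lia)).weaken le_rfl (by simp; lia) le_rfl)
        (.mono (hf.of_le (by exact_mod_cast Nat.le_succ r)) (by simp) (fun i hi => ?_)
          (by simp; lia)), fun v hv x => ?_⟩
    · rcases List.mem_cons.1 hi with rfl | hi
      · lia
      · have := hq i (List.mem_cons_of_mem _ hi); lia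
    · have h1 := (hd v hv x).mul (hasDerivAt_iteratedDeriv hv (l := j) (by lia) x)
      have e : diffMono f (j :: L) v = fun x => diffMono f L v x * iteratedDeriv j v x := by
        funext x; simp only [diffMono, List.map_cons, List.prod_cons]; ring
      rw [e]
      convert! h1 using 1
      simp only [diffMono, List.map_cons, List.prod_cons]; ring

theorem DiffPoly.exists_deriv {r n q : ℕ} {Φ : (ℝ → ℝ) → ℝ → ℝ} (h : DiffPoly (r + 1) n q Φ) :
    ∃ Ψ, DiffPoly r (n + 1) (q + 1) Ψ ∧ ∀ v, ContDiff ℝ (q + 1 : ℕ) v → ∀ x,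
      HasDerivAt (Φ v) (Ψ v x) x := by
  induction h with
  | @mono f L hf hL hq hn =>
    obtain ⟨Ψ, h1, h2⟩ := exists_deriv_diffMono hf L hq
    exact ⟨Ψ, h1.weaken le_rfl (by lia) le_rfl, h2⟩
  | zero => exact ⟨_, .zero, fun _ _ x => hasDerivAt_const x 0⟩
  | add _ _ ih ih' =>
    obtain ⟨Ψ, h1, h2⟩ := ih
    obtain ⟨Ψ', h1', h2'⟩ := ih'
    exact ⟨_, h1.add h1', fun v hv x => (h2 v hv x).add (h2' v hv x)⟩

/-! ### Tame estimates -/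

/-- The square of the norm of `H^s`, through classical derivatives. -/
noncomputable def hSq (s : ℕ) (v : ℝ → ℝ) : ℝ :=
  ∑ l ∈ Finset.range (s + 1), ∫ x, iteratedDeriv l v x ^ 2

theorem integral_sq_nonneg (f : ℝ → ℝ) : 0 ≤ ∫ x, f x ^ 2 := integral_nonneg fun _ => sq_nonneg _

theorem hSq_nonneg (s : ℕ) (v : ℝ → ℝ) : 0 ≤ hSq s v :=
  Finset.sum_nonneg fun _ _ => integral_sq_nonneg _

theorem integral_sq_le_hSq {s l : ℕ} (hl : l ≤ s) (v : ℝ → ℝ) :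
    ∫ x, iteratedDeriv l v x ^ 2 ≤ hSq s v :=
  Finset.single_le_sum (f := fun l => ∫ x, iteratedDeriv l v x ^ 2)
    (fun _ _ => integral_sq_nonneg _) (Finset.mem_range.2 (by lia))

theorem iteratedDeriv_iteratedDeriv' (i j : ℕ) (v : ℝ → ℝ) :
    iteratedDeriv i (iteratedDeriv j v) = iteratedDeriv (i + j) v := by
  simp only [iteratedDeriv_eq_iterate, Function.iterate_add_apply]

theorem Sob.iteratedDeriv {k j : ℕ} {v : ℝ → ℝ} (hv : Sob (k + j) v) : Sob k (iteratedDeriv j v) := by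
  refine ⟨contDiff_nat_iff_iteratedDeriv.2 ⟨fun m hm => ?_, fun m hm => ?_⟩, fun l hl => ?_⟩
  · rw [iteratedDeriv_iteratedDeriv']; exact hv.continuous (by lia)
  · rw [iteratedDeriv_iteratedDeriv']
    exact fun x => (hv.hasDerivAt (by lia) x).differentiableAt
  · rw [iteratedDeriv_iteratedDeriv']; exact hv.memLp (by lia)

theorem Sob.weaken {k j : ℕ} {v : ℝ → ℝ} (hv : Sob k v) (h : j ≤ k) : Sob j v :=
  ⟨hv.1.of_le (by exact_mod_cast h), fun l hl => hv.2 l (hl.trans h)⟩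

theorem exists_bound_coeff {f : ℝ → ℝ} (hf : Continuous f) (M : ℝ) :
    ∃ A : ℝ, 0 ≤ A ∧ ∀ y, |y| ≤ M → |f y| ≤ A := by
  obtain ⟨A, hA⟩ := (isCompact_Icc (a := -M) (b := M)).exists_bound_of_continuousOn hf.continuousOn
  exact ⟨|A|, abs_nonneg _, fun y hy => (hA y (abs_le.1 hy)).trans (le_abs_self A)⟩

/-- If a single factor has order above 3, the excess is at most q-3; if there are two or more, at
least 6 is lost from the total. With total order at most s+3 and q ≤ s, a positive excess is
therefore at most s-3, so interpolating ∂ₓ³v up to that order uses no more than s derivatives of v.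
-/
theorem excess_le {q : ℕ} (L : List ℕ) (hq : ∀ j ∈ L, j ≤ q) :
    ((L.map fun j => j - 3).sum = 0 ∨ (L.map fun j => j - 3).sum + 3 ≤ L.sum) ∧
      ((L.map fun j => j - 3).sum ≤ q - 3 ∨ (L.map fun j => j - 3).sum + 6 ≤ L.sum) := by
  induction L with
  | nil => simp
  | cons j L ih =>
    have := ih fun i hi => hq i (List.mem_cons_of_mem _ hi)
    have := hq j List.mem_cons_self
    simp only [List.map_cons, List.sum_cons]
    lia

theorem abs_prod_le {v : ℝ → ℝ} {x M D : ℝ} (hM : 1 ≤ M) (hD : 0 ≤ D) (L : List ℕ)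
    (h : ∀ j ∈ L, |iteratedDeriv j v x| ≤ M * D ^ (j - 3)) :
    |(L.map fun j => iteratedDeriv j v x).prod| ≤
      M ^ L.length * D ^ (L.map fun j => j - 3).sum := by
  induction L with
  | nil => simp
  | cons j L ih =>
    have h1 := ih fun i hi => h i (List.mem_cons_of_mem _ hi)
    have h2 := h j List.mem_cons_self
    simp only [List.map_cons, List.prod_cons, List.length_cons, List.sum_cons, abs_mul]
    calc _ ≤ M * D ^ (j - 3) * (M ^ L.length * D ^ (L.map fun j => j - 3).sum) := by gcongr
      _ = _ := by ring

theorem memLp_two_of_sq_le {f g : ℝ → ℝ} (hf : Continuous f) (hg : Integrable g)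
    (h : ∀ x, f x ^ 2 ≤ g x) : MemLp f 2 ∧ ∫ x, f x ^ 2 ≤ ∫ x, g x := by
  have hi : Integrable fun x => f x ^ 2 := integrable_of_abs_le (hf.pow 2) hg fun x => by
    rw [abs_of_nonneg (sq_nonneg _)]; exact h x
  exact ⟨(memLp_two_iff_integrable_sq hf.aestronglyMeasurable).2 hi, integral_mono hi hg h⟩

/-- Let W = ∂ₓ³v and let e be the excess. Hölder's inequality is replaced by a pointwise bound: if S
is the sum of the |∂ⁱW|^(2e/i) for 1 ≤ i ≤ e and D^(2e) = S, then |∂ⁱW| ≤ Dⁱ. The monomial is thus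
at most a constant times D^e, whose square S is controlled by Gagliardo–Nirenberg. -/
theorem diffMono_tame {s q : ℕ} {f : ℝ → ℝ} {L : List ℕ} (hf : Continuous f)
    (hL : L ≠ []) (hq : ∀ j ∈ L, 1 ≤ j ∧ j ≤ q) (hn : L.sum ≤ s + 3) (hqs : q ≤ s)
    (M : ℝ) :
    ∃ C : ℝ, 0 ≤ C ∧ ∀ v, Sob (s + 2) v → (∀ k ≤ 3, ∀ x, |iteratedDeriv k v x| ≤ M) →
      MemLp (diffMono f L v) 2 ∧ ∫ x, diffMono f L v x ^ 2 ≤ C * hSq s v := by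
  obtain ⟨A, hA, hfA⟩ := exists_bound_coeff hf M
  set M1 := max M 1 with hM1
  have h1M : 1 ≤ M1 := le_max_right _ _
  have hcont : ∀ v, Sob (s + 2) v → Continuous (diffMono f L v) := fun v hv => by
    refine (hf.comp hv.1.continuous).mul (continuous_list_prod _ fun j hj => ?_)
    exact hv.continuous (by have := hq j hj; lia)
  set e := (L.map fun j => j - 3).sum with he
  -- If no factor has order above 3, the first one is kept in L² and the others are bounded; this
  -- requires a nonempty list.
  rcases Nat.eq_zero_or_pos e with he0 | he0
  · obtain ⟨j, L', rfl⟩ := List.exists_cons_of_ne_nil hL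
    simp only [List.map_cons, List.sum_cons] at he
    have hj := hq j List.mem_cons_self
    refine ⟨(A * M1 ^ L'.length) ^ 2, sq_nonneg _, fun v hv hvM => ?_⟩
    have key : ∀ x, diffMono f (j :: L') v x ^ 2 ≤
        (A * M1 ^ L'.length) ^ 2 * iteratedDeriv j v x ^ 2 := fun x => by
      have h1 := abs_prod_le (v := v) (x := x) h1M zero_le_one L' (fun i hi => by
        have h3 : i ≤ 3 := by
          have := List.single_le_sum (l := L'.map fun j => j - 3) (fun _ _ => Nat.zero_le _)
            (i - 3) (List.mem_map_of_mem hi)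
          lia
        rw [one_pow, mul_one]
        exact (hvM i h3 x).trans (le_max_left _ _))
      rw [one_pow, mul_one] at h1
      have h2 := hfA (v x) (by simpa using hvM 0 (by lia) x)
      rw [← mul_pow]
      refine sq_le_sq.2 ?_
      rw [abs_mul (A * _), abs_of_nonneg (by positivity : 0 ≤ A * M1 ^ L'.length), diffMono,
        abs_mul, List.map_cons, List.prod_cons, abs_mul]
      calc _ ≤ A * (|iteratedDeriv j v x| * M1 ^ L'.length) := by gcongr
        _ = _ := by ring
    have h := memLp_two_of_sq_le (hcont v hv) ((hv.memLp (l := j) (by lia)).integrable_sq.const_mul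
      ((A * M1 ^ L'.length) ^ 2)) key
    refine ⟨h.1, h.2.trans ?_⟩
    rw [integral_const_mul]
    exact mul_le_mul_of_nonneg_left (integral_sq_le_hSq (by lia) v) (sq_nonneg _)
  · have hes : e + 3 ≤ s := by
      have := excess_le L (q := q) fun j hj => (hq j hj).2
      lia
    obtain ⟨C, hC, hI⟩ := exists_interpolation e M1 (by linarith)
    refine ⟨(A * M1 ^ L.length) ^ 2 * (e * C), by positivity, fun v hv hvM => ?_⟩
    set W := iteratedDeriv 3 v with hW
    have hWs : Sob (e + 1) W := (hv.weaken (by lia) : Sob (e + 1 + 3) v).iteratedDeriv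
    have hWM : ∀ x, |W x| ≤ M1 := fun x => (hvM 3 le_rfl x).trans (le_max_left _ _)
    set S : ℝ → ℝ := fun x => ∑ i ∈ Finset.Icc 1 e, |iteratedDeriv i W x| ^ (2 * e / i : ℝ) with hS
    have hS0 : ∀ x, 0 ≤ S x := fun x => Finset.sum_nonneg fun i _ => by positivity
    have hSi : Integrable S := integrable_finsetSum _ fun i hi => by
      rw [Finset.mem_Icc] at hi; exact (hI i hi.1 hi.2 W hWs hWM).1
    have hSle : ∫ x, S x ≤ e * C * hSq s v := by
      rw [hS, integral_finsetSum _ fun i hi => by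
        rw [Finset.mem_Icc] at hi; exact (hI i hi.1 hi.2 W hWs hWM).1]
      calc _ ≤ ∑ i ∈ Finset.Icc 1 e, C * hSq s v := Finset.sum_le_sum fun i hi => by
            rw [Finset.mem_Icc] at hi
            refine (hI i hi.1 hi.2 W hWs hWM).2.trans (mul_le_mul_of_nonneg_left ?_ hC)
            rw [hW, iteratedDeriv_iteratedDeriv']
            exact integral_sq_le_hSq hes v
        _ = _ := by simp; ring
    have key : ∀ x, diffMono f L v x ^ 2 ≤ (A * M1 ^ L.length) ^ 2 * S x := fun x => by
      have he' : (0 : ℝ) < e := by exact_mod_cast he0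
      set D := S x ^ (1 / (2 * e) : ℝ) with hD
      have hD0 : 0 ≤ D := Real.rpow_nonneg (hS0 x) _
      have hDe : (D ^ e) ^ 2 = S x := by
        rw [← pow_mul, hD, ← Real.rpow_natCast, ← Real.rpow_mul (hS0 x)]
        have : (1 / (2 * e) * (e * 2 : ℕ) : ℝ) = 1 := by push_cast; field_simp
        rw [this, Real.rpow_one]
      have h1 := abs_prod_le (v := v) (x := x) h1M hD0 L (fun j hj => by
        have hje : j - 3 ≤ e :=
          List.single_le_sum (l := L.map fun j => j - 3) (fun _ _ => Nat.zero_le _)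
            (j - 3) (List.mem_map_of_mem hj)
        rcases Nat.lt_or_ge 3 j with h3 | h3
        · obtain ⟨i, rfl⟩ : ∃ i, j = i + 3 := ⟨j - 3, by lia⟩
          have hi : i ∈ Finset.Icc 1 e := Finset.mem_Icc.2 ⟨by lia, by lia⟩
          have hi0 : (0 : ℝ) < i := by exact_mod_cast (by lia : 0 < i)
          have hle : |iteratedDeriv i W x| ^ (2 * e / i : ℝ) ≤ S x :=
            Finset.single_le_sum (f := fun i : ℕ => |iteratedDeriv i W x| ^ (2 * e / i : ℝ))
              (fun i _ => by positivity) hi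
          rw [hW, iteratedDeriv_iteratedDeriv'] at hle
          have h4 := Real.rpow_le_rpow (by positivity) hle (by positivity : 0 ≤ (i / (2 * e) : ℝ))
          rw [← Real.rpow_mul (abs_nonneg _)] at h4
          have : (2 * e / i * (i / (2 * e)) : ℝ) = 1 := by field_simp
          rw [this, Real.rpow_one] at h4
          have h5 : S x ^ (i / (2 * e) : ℝ) = D ^ i := by
            rw [hD, ← Real.rpow_natCast, ← Real.rpow_mul (hS0 x)]; congr 1; field_simp
          rw [h5] at h4
          rw [Nat.add_sub_cancel]
          exact h4.trans (le_mul_of_one_le_left (by positivity) h1M)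
        · rw [Nat.sub_eq_zero_of_le h3, pow_zero, mul_one]
          exact (hvM j h3 x).trans (le_max_left _ _))
      have h2 := hfA (v x) (by simpa using hvM 0 (by lia) x)
      rw [← hDe, ← mul_pow]
      refine sq_le_sq.2 ?_
      rw [abs_of_nonneg (by positivity : 0 ≤ A * M1 ^ L.length * D ^ e), diffMono, abs_mul, mul_assoc]
      exact mul_le_mul h2 h1 (abs_nonneg _) hA
    have h := memLp_two_of_sq_le (hcont v hv) (hSi.const_mul _) key
    refine ⟨h.1, h.2.trans ?_⟩
    rw [integral_const_mul, mul_assoc]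
    exact mul_le_mul_of_nonneg_left hSle (sq_nonneg _)

theorem DiffPoly.tame {s r n q : ℕ} {Φ : (ℝ → ℝ) → ℝ → ℝ} (h : DiffPoly r n q Φ)
    (hn : n ≤ s + 3) (hqs : q ≤ s) (M : ℝ) :
    ∃ C : ℝ, 0 ≤ C ∧ ∀ v, Sob (s + 2) v → (∀ k ≤ 3, ∀ x, |iteratedDeriv k v x| ≤ M) →
      MemLp (Φ v) 2 ∧ ∫ x, Φ v x ^ 2 ≤ C * hSq s v := by
  induction h with
  | mono hf hL hq hn' =>
    exact diffMono_tame hf.continuous hL hq (hn'.trans hn) hqs M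
  | zero =>
    refine ⟨0, le_rfl, fun v _ _ => ⟨MemLp.zero', by simp⟩⟩
  | add _ _ ih ih' =>
    obtain ⟨C, hC, h⟩ := ih
    obtain ⟨C', hC', h'⟩ := ih'
    refine ⟨2 * C + 2 * C', by positivity, fun v hv hvM => ?_⟩
    have h1 := h v hv hvM
    have h2 := h' v hv hvM
    refine ⟨h1.1.add h2.1, ?_⟩
    have hle := integral_mono (h1.1.add h2.1).integrable_sq
      ((h1.1.integrable_sq.const_mul 2).add (h2.1.integrable_sq.const_mul 2)) fun x => by
        exact add_sq_le.trans (le_of_eq (by simp only [Pi.add_apply]; ring))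
    simp only [Pi.add_apply] at hle
    rw [integral_add (h1.1.integrable_sq.const_mul 2) (h2.1.integrable_sq.const_mul 2),
      integral_const_mul, integral_const_mul] at hle
    linarith [h1.2, h2.2]

/-! ### Structure of the equation -/

/-- The flux `κ(v) ∂ₓ² v + ½ κ'(v) (∂ₓ v)² + p(v)`. -/
noncomputable def flux (κ p : ℝ → ℝ) (v : ℝ → ℝ) (x : ℝ) : ℝ :=
  κ (v x) * iteratedDeriv 2 v x + 1 / 2 * (deriv κ (v x) * iteratedDeriv 1 v x ^ 2) + p (v x)

theorem contDiff_iteratedDeriv_nat {n l : ℕ} {v : ℝ → ℝ} (hv : ContDiff ℝ (n + l : ℕ) v) :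
    ContDiff ℝ n (iteratedDeriv l v) := by
  refine contDiff_nat_iff_iteratedDeriv.2 ⟨fun m hm => ?_, fun m hm => ?_⟩
  · rw [iteratedDeriv_iteratedDeriv']
    exact hv.continuous_iteratedDeriv _ (by exact_mod_cast (by lia : m + l ≤ n + l))
  · rw [iteratedDeriv_iteratedDeriv']
    exact hv.differentiable_iteratedDeriv _ (by exact_mod_cast (by lia : m + l < n + l))

theorem contDiff_of_le {n m : ℕ} {f : ℝ → ℝ} (hf : ContDiff ℝ n f) (h : m ≤ n) : ContDiff ℝ m f :=
  hf.of_le (by exact_mod_cast h)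

theorem contDiff_flux {s : ℕ} {κ p v : ℝ → ℝ} (hκ : ContDiff ℝ (s + 2 : ℕ) κ)
    (hp : ContDiff ℝ (s + 1 : ℕ) p) (hv : ContDiff ℝ (s + 2 : ℕ) v) :
    ContDiff ℝ s (flux κ p v) := by
  have hv0 := contDiff_of_le hv (by lia : s ≤ s + 2)
  have hv1 : ContDiff ℝ s (iteratedDeriv 1 v) :=
    contDiff_iteratedDeriv_nat (contDiff_of_le hv (by lia))
  have hv2 : ContDiff ℝ s (iteratedDeriv 2 v) := contDiff_iteratedDeriv_nat hv
  have h0 := (contDiff_of_le hκ (by lia : s ≤ s + 2)).comp hv0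
  have h1 := (contDiff_of_le (ContDiff.deriv_nat hκ) (by lia : s ≤ s + 1)).comp hv0
  have h2 := (contDiff_of_le hp (by lia : s ≤ s + 1)).comp hv0
  exact ((h0.mul hv2).add (contDiff_const.mul (h1.mul (hv1.pow 2)))).add h2

/-- The zeroth order coefficient in the expansion of `∂ₓˡ` of the flux. -/
noncomputable def lowerCoeff (κ p : ℝ → ℝ) (α β : ℝ) (v : ℝ → ℝ) (x : ℝ) : ℝ :=
  α * (deriv κ (v x) * iteratedDeriv 2 v x) +
    β * (deriv (deriv κ) (v x) * iteratedDeriv 1 v x ^ 2) + deriv p (v x)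

theorem exists_deriv_lowerCoeff {s : ℕ} (hs : 1 ≤ s) {κ p : ℝ → ℝ} (hκ : ContDiff ℝ (s + 2 : ℕ) κ)
    (hp : ContDiff ℝ (s + 1 : ℕ) p) (α β : ℝ) :
    ∃ Φ, DiffPoly (s - 1) 3 3 Φ ∧ ∀ v, ContDiff ℝ (s + 2 : ℕ) v → ∀ x,
      HasDerivAt (lowerCoeff κ p α β v) (Φ v x) x := by
  obtain ⟨n, rfl⟩ : ∃ n, s = n + 1 := ⟨s - 1, by lia⟩
  have k1 := ContDiff.deriv_nat hκ
  have k2 := ContDiff.deriv_nat k1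
  have k3 := ContDiff.deriv_nat k2
  have p1 := ContDiff.deriv_nat hp
  have p2 := ContDiff.deriv_nat p1
  have d1 : DiffPoly n 3 3 fun v x =>
      (α + 2 * β) * deriv (deriv κ) (v x) * (iteratedDeriv 1 v x * iteratedDeriv 2 v x) :=
    .ofList [1, 2] ((contDiff_const (c := α + 2 * β)).mul (contDiff_of_le k2 (by lia))) (by simp)
  have d2 : DiffPoly n 3 3 fun v x => α * deriv κ (v x) * iteratedDeriv 3 v x :=
    .ofList [3] ((contDiff_const (c := α)).mul (contDiff_of_le k1 (by lia))) (by simp)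
  have d3 : DiffPoly n 3 3 fun v x => β * deriv (deriv (deriv κ)) (v x) *
      (iteratedDeriv 1 v x * (iteratedDeriv 1 v x * iteratedDeriv 1 v x)) :=
    .ofList [1, 1, 1] ((contDiff_const (c := β)).mul k3) (by simp)
  have d4 : DiffPoly n 3 3 fun v x => deriv (deriv p) (v x) * iteratedDeriv 1 v x :=
    .ofList [1] p2 (by simp)
  refine ⟨_, ((d1.add d2).add d3).add d4, fun v hv x => ?_⟩
  have c1 := hasDerivAt_coeff k1 hv x
  have c2 := hasDerivAt_coeff k2 hv x
  have c3 := hasDerivAt_coeff p1 hv x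
  have v1 := hasDerivAt_iteratedDeriv hv (l := 1) (by lia) x
  have v2 := hasDerivAt_iteratedDeriv hv (l := 2) (by lia) x
  convert! (((c1.mul v2).const_mul α).add ((c2.mul (v1.pow 2)).const_mul β)).add c3 using 1
  push_cast
  simp only [pow_one, Pi.pow_apply]
  ring

theorem iteratedDeriv_flux_one {s : ℕ} (hs : 4 ≤ s) {κ p : ℝ → ℝ}
    (hκ : ContDiff ℝ (s + 2 : ℕ) κ) (hp : ContDiff ℝ (s + 1 : ℕ) p) {v : ℝ → ℝ}
    (hv : ContDiff ℝ (s + 2 : ℕ) v) (x : ℝ) :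
    iteratedDeriv 1 (flux κ p v) x = κ (v x) * iteratedDeriv 3 v x +
      2 * (deriv κ (v x) * iteratedDeriv 1 v x) * iteratedDeriv 2 v x +
      lowerCoeff κ p 0 (1 / 2) v x * iteratedDeriv 1 v x := by
  have c0 := hasDerivAt_coeff hκ hv x
  have c1 := hasDerivAt_coeff (ContDiff.deriv_nat hκ) hv x
  have c2 := hasDerivAt_coeff hp hv x
  have v1 := hasDerivAt_iteratedDeriv hv (l := 1) (by lia) x
  have v2 := hasDerivAt_iteratedDeriv hv (l := 2) (by lia) x
  have h := ((c0.mul v2).add ((c1.mul (v1.pow 2)).const_mul (1 / 2))).add c2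
  rw [iteratedDeriv_one]
  refine h.deriv.trans ?_
  simp only [lowerCoeff, Pi.pow_apply, Nat.reduceAdd, Nat.cast_ofNat]
  ring

theorem iteratedDeriv_flux_two {s : ℕ} (hs : 4 ≤ s) {κ p : ℝ → ℝ}
    (hκ : ContDiff ℝ (s + 2 : ℕ) κ) (hp : ContDiff ℝ (s + 1 : ℕ) p) {v : ℝ → ℝ}
    (hv : ContDiff ℝ (s + 2 : ℕ) v) (x : ℝ) :
    iteratedDeriv 2 (flux κ p v) x = κ (v x) * iteratedDeriv 4 v x +
      3 * (deriv κ (v x) * iteratedDeriv 1 v x) * iteratedDeriv 3 v x +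
      lowerCoeff κ p 2 (5 / 2) v x * iteratedDeriv 2 v x +
      (1 / 2 * (deriv (deriv (deriv κ)) (v x) * iteratedDeriv 1 v x ^ 4) +
        deriv (deriv κ) (v x) * (iteratedDeriv 1 v x ^ 2 * iteratedDeriv 2 v x) +
        deriv (deriv p) (v x) * iteratedDeriv 1 v x ^ 2) := by
  obtain ⟨n, rfl⟩ : ∃ n, s = n + 2 := ⟨s - 2, by lia⟩
  have c0 := hasDerivAt_coeff hκ hv x
  have c1 := hasDerivAt_coeff (ContDiff.deriv_nat hκ) hv x
  have c2 := hasDerivAt_coeff (ContDiff.deriv_nat (ContDiff.deriv_nat hκ)) hv x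
  have p1 := hasDerivAt_coeff (ContDiff.deriv_nat hp) hv x
  have v1 := hasDerivAt_iteratedDeriv hv (l := 1) (by lia) x
  have v2 := hasDerivAt_iteratedDeriv hv (l := 2) (by lia) x
  have v3 := hasDerivAt_iteratedDeriv hv (l := 3) (by lia) x
  have h := ((c0.mul v3).add (((c1.mul v1).const_mul 2).mul v2)).add
    ((((c1.mul v2).const_mul 0).add ((c2.mul (v1.pow 2)).const_mul (1 / 2))).add p1 |>.mul v1)
  rw [iteratedDeriv_succ, funext (iteratedDeriv_flux_one hs hκ hp hv)]
  refine h.deriv.trans ?_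
  simp only [lowerCoeff, Pi.pow_apply, Pi.mul_apply, Pi.add_apply, Nat.reduceAdd, Nat.cast_ofNat]
  ring

theorem iteratedDeriv_flux_three {s : ℕ} (hs : 4 ≤ s) {κ p : ℝ → ℝ}
    (hκ : ContDiff ℝ (s + 2 : ℕ) κ) (hp : ContDiff ℝ (s + 1 : ℕ) p) {v : ℝ → ℝ}
    (hv : ContDiff ℝ (s + 2 : ℕ) v) (x : ℝ) :
    iteratedDeriv 3 (flux κ p v) x = κ (v x) * iteratedDeriv 5 v x +
      4 * (deriv κ (v x) * iteratedDeriv 1 v x) * iteratedDeriv 4 v x +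
      lowerCoeff κ p 7 (13 / 2) v x * iteratedDeriv 3 v x +
      (1 / 2 * (deriv (deriv (deriv (deriv κ))) (v x) * iteratedDeriv 1 v x ^ 5) +
        11 / 2 * (deriv (deriv (deriv κ)) (v x) * (iteratedDeriv 1 v x ^ 3 * iteratedDeriv 2 v x)) +
        9 * (deriv (deriv κ) (v x) * (iteratedDeriv 1 v x * iteratedDeriv 2 v x ^ 2)) +
        deriv (deriv (deriv p)) (v x) * iteratedDeriv 1 v x ^ 3 +
        3 * (deriv (deriv p) (v x) * (iteratedDeriv 1 v x * iteratedDeriv 2 v x))) := by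
  obtain ⟨n, rfl⟩ : ∃ n, s = n + 2 := ⟨s - 2, by lia⟩
  have c0 := hasDerivAt_coeff hκ hv x
  have c1 := hasDerivAt_coeff (ContDiff.deriv_nat hκ) hv x
  have k2 := ContDiff.deriv_nat (ContDiff.deriv_nat hκ)
  have c2 := hasDerivAt_coeff k2 hv x
  have c3 := hasDerivAt_coeff (ContDiff.deriv_nat k2) hv x
  have p1 := hasDerivAt_coeff (ContDiff.deriv_nat hp) hv x
  have p2 := hasDerivAt_coeff (ContDiff.deriv_nat (ContDiff.deriv_nat hp)) hv x
  have v1 := hasDerivAt_iteratedDeriv hv (l := 1) (by lia) x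
  have v2 := hasDerivAt_iteratedDeriv hv (l := 2) (by lia) x
  have v3 := hasDerivAt_iteratedDeriv hv (l := 3) (by lia) x
  have v4 := hasDerivAt_iteratedDeriv hv (l := 4) (by lia) x
  have h := (((c0.mul v4).add (((c1.mul v1).const_mul 3).mul v3)).add
    ((((c1.mul v2).const_mul 2).add ((c2.mul (v1.pow 2)).const_mul (5 / 2))).add p1 |>.mul v2)).add
    ((((c3.mul (v1.pow 4)).const_mul (1 / 2)).add (c2.mul ((v1.pow 2).mul v2))).add
      (p2.mul (v1.pow 2)))
  rw [iteratedDeriv_succ, funext (iteratedDeriv_flux_two hs hκ hp hv)]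
  refine h.deriv.trans ?_
  simp only [lowerCoeff, Pi.pow_apply, Pi.mul_apply, Pi.add_apply, Nat.reduceAdd, Nat.cast_ofNat]
  ring

/-- From l = 3 on, differentiating the middle coefficient (l+1)κ'v_x raises both α and β by l+1, and
the other new terms go into `R`. At worst κ^(l+1) and p^(l) occur in `R`, whence the class
C^(s+1-l): even at l = s one derivative of `R` remains. -/
theorem exists_iteratedDeriv_flux {s : ℕ} (hs : 4 ≤ s) {κ p : ℝ → ℝ}
    (hκ : ContDiff ℝ (s + 2 : ℕ) κ) (hp : ContDiff ℝ (s + 1 : ℕ) p) (l : ℕ) (hl : 1 ≤ l)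
    (hls : l ≤ s) :
    ∃ (α β : ℝ) (R : (ℝ → ℝ) → ℝ → ℝ), DiffPoly (s + 1 - l) (l + 2) (max (l - 1) 2) R ∧
      ∀ v, ContDiff ℝ (s + 2 : ℕ) v → ∀ x, iteratedDeriv l (flux κ p v) x =
        κ (v x) * iteratedDeriv (l + 2) v x +
          (l + 1) * (deriv κ (v x) * iteratedDeriv 1 v x) * iteratedDeriv (l + 1) v x +
          lowerCoeff κ p α β v x * iteratedDeriv l v x + R v x := by
  have k1 := ContDiff.deriv_nat hκ
  obtain ⟨n, rfl⟩ : ∃ n, s = n + 2 := ⟨s - 2, by lia⟩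
  have k2 := ContDiff.deriv_nat k1
  have k3 := ContDiff.deriv_nat k2
  have k4 := ContDiff.deriv_nat k3
  have q2 := ContDiff.deriv_nat (ContDiff.deriv_nat hp)
  have q3 := ContDiff.deriv_nat q2
  rcases (by lia : l = 1 ∨ l = 2 ∨ 3 ≤ l) with rfl | rfl | hl3
  · refine ⟨0, 1 / 2, _, .zero, fun v hv x => ?_⟩
    rw [iteratedDeriv_flux_one hs hκ hp hv]
    norm_num
  · have d1 : DiffPoly (n + 1) 4 2 fun v x => 1 / 2 * deriv (deriv (deriv κ)) (v x) *
        (iteratedDeriv 1 v x * (iteratedDeriv 1 v x * (iteratedDeriv 1 v x *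
          iteratedDeriv 1 v x))) := .ofList [1, 1, 1, 1] ((contDiff_const (c := 1 / 2)).mul k3) (by simp)
    have d2 : DiffPoly (n + 1) 4 2 fun v x => deriv (deriv κ) (v x) *
        (iteratedDeriv 1 v x * (iteratedDeriv 1 v x * iteratedDeriv 2 v x)) :=
      .ofList [1, 1, 2] (contDiff_of_le k2 (by lia)) (by simp)
    have d3 : DiffPoly (n + 1) 4 2 fun v x => deriv (deriv p) (v x) *
        (iteratedDeriv 1 v x * iteratedDeriv 1 v x) := .ofList [1, 1] q2 (by simp)
    refine ⟨2, 5 / 2, _, ((d1.add d2).add d3).weaken (by lia) le_rfl (by lia), fun v hv x => ?_⟩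
    rw [iteratedDeriv_flux_two hs hκ hp hv]
    push_cast
    ring
  -- The derivative of `lowerCoeff` contains ∂ₓ³v, multiplied by ∂ₓˡv, and this fits into the new
  -- remainder only if l ≥ 3. In passing from 2 to 3 such terms join the `lowerCoeff` term instead,
  -- so the values 7 and 13/2 do not follow the recursion.
  induction l, hl3 using Nat.le_induction with
  | base =>
    have d1 : DiffPoly n 5 2 fun v x => 1 / 2 * deriv (deriv (deriv (deriv κ))) (v x) *
        (iteratedDeriv 1 v x * (iteratedDeriv 1 v x * (iteratedDeriv 1 v x *
          (iteratedDeriv 1 v x * iteratedDeriv 1 v x)))) :=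
      .ofList [1, 1, 1, 1, 1] ((contDiff_const (c := 1 / 2)).mul k4) (by simp)
    have d2 : DiffPoly n 5 2 fun v x => 11 / 2 * deriv (deriv (deriv κ)) (v x) *
        (iteratedDeriv 1 v x * (iteratedDeriv 1 v x * (iteratedDeriv 1 v x *
          iteratedDeriv 2 v x))) :=
      .ofList [1, 1, 1, 2] ((contDiff_const (c := 11 / 2)).mul (contDiff_of_le k3 (by lia))) (by simp)
    have d3 : DiffPoly n 5 2 fun v x => 9 * deriv (deriv κ) (v x) *
        (iteratedDeriv 1 v x * (iteratedDeriv 2 v x * iteratedDeriv 2 v x)) :=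
      .ofList [1, 2, 2] ((contDiff_const (c := 9)).mul (contDiff_of_le k2 (by lia))) (by simp)
    have d4 : DiffPoly n 5 2 fun v x => deriv (deriv (deriv p)) (v x) *
        (iteratedDeriv 1 v x * (iteratedDeriv 1 v x * iteratedDeriv 1 v x)) :=
      .ofList [1, 1, 1] q3 (by simp)
    have d5 : DiffPoly n 5 2 fun v x => 3 * deriv (deriv p) (v x) *
        (iteratedDeriv 1 v x * iteratedDeriv 2 v x) :=
      .ofList [1, 2] ((contDiff_const (c := 3)).mul (contDiff_of_le q2 (by lia))) (by simp)
    refine ⟨7, 13 / 2, _, ((((d1.add d2).add d3).add d4).add d5).weaken (by lia) le_rfl (by lia),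
      fun v hv x => ?_⟩
    rw [iteratedDeriv_flux_three hs hκ hp hv]
    push_cast
    ring
  | succ l hl3 ih =>
    obtain ⟨α, β, R, hR, h⟩ := ih (by lia) (by lia)
    obtain ⟨Φ, hΦ, hΦd⟩ := exists_deriv_lowerCoeff (by lia) hκ hp α β
    obtain ⟨R', hR', hRd⟩ :=
      (hR.weaken (r' := (n + 2 - l) + 1) (by lia) le_rfl le_rfl).exists_deriv
    refine ⟨α + (l + 1), β + (l + 1), _,
      ((hΦ.weaken (r' := n + 2 - l) (n' := 3) (q' := l) (by lia) le_rfl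
        (by lia)).mul_iteratedDeriv (by lia) le_rfl).weaken (by lia) (by lia) (by lia) |>.add
        (hR'.weaken (by lia) (by lia) (by lia)), fun v hv x => ?_⟩
    rw [iteratedDeriv_succ, funext (h v hv)]
    have c0 := hasDerivAt_coeff hκ hv x
    have c1 := hasDerivAt_coeff k1 hv x
    have v1 := hasDerivAt_iteratedDeriv hv (l := 1) (by lia) x
    have vl := hasDerivAt_iteratedDeriv hv (l := l) (by lia) x
    have vl1 := hasDerivAt_iteratedDeriv hv (l := l + 1) (by lia) x
    have vl2 := hasDerivAt_iteratedDeriv hv (l := l + 2) (by lia) x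
    have hh := (((c0.mul vl2).add (((c1.mul v1).const_mul ((l : ℝ) + 1)).mul vl1)).add
      ((hΦd v hv x).mul vl)).add (hRd v (contDiff_of_le hv (by lia)) x)
    refine hh.deriv.trans ?_
    simp only [lowerCoeff, Pi.mul_apply]
    push_cast
    ring

/-! ### The energy estimate at a fixed time -/

/-- The 3-jet of `v`. -/
noncomputable def jet (v : ℝ → ℝ) (x : ℝ) : ℝ × ℝ × ℝ × ℝ :=
  (v x, iteratedDeriv 1 v x, iteratedDeriv 2 v x, iteratedDeriv 3 v x)

theorem exists_bound_jet {Z : ℝ × ℝ × ℝ × ℝ → ℝ} (hZ : Continuous Z) (M : ℝ) :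
    ∃ A : ℝ, 0 ≤ A ∧ ∀ v : ℝ → ℝ, (∀ k ≤ 3, ∀ x, |iteratedDeriv k v x| ≤ M) →
      ∀ x, |Z (jet v x)| ≤ A := by
  obtain ⟨A, hA⟩ := (isCompact_closedBall (0 : ℝ × ℝ × ℝ × ℝ) M).exists_bound_of_continuousOn
    hZ.continuousOn
  refine ⟨|A|, abs_nonneg _, fun v hv x => (hA _ ?_).trans (le_abs_self A)⟩
  rw [mem_closedBall_zero_iff]
  have h0 := hv 0 (by lia) x
  rw [iteratedDeriv_zero] at h0
  simp only [jet, Prod.norm_def, Real.norm_eq_abs]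
  exact max_le h0 (max_le (hv 1 (by lia) x) (max_le (hv 2 (by lia) x) (hv 3 le_rfl x)))

theorem continuous_jet {v : ℝ → ℝ} (hv : ContDiff ℝ (3 : ℕ) v) : Continuous (jet v) :=
  hv.continuous.prodMk ((hv.continuous_iteratedDeriv 1 (by norm_num)).prodMk
    ((hv.continuous_iteratedDeriv 2 (by norm_num)).prodMk
      (hv.continuous_iteratedDeriv 3 (by norm_num))))

theorem MemLp.bdd_mul_two {b f : ℝ → ℝ} {B : ℝ} (hb : Continuous b) (hB : ∀ x, |b x| ≤ B)
    (hf : MemLp f 2) : MemLp (fun x => b x * f x) 2 :=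
  hf.of_le_mul (c := B) (hb.aestronglyMeasurable.mul hf.1) (ae_of_all _ fun x => by
    rw [norm_mul]; exact mul_le_mul_of_nonneg_right (hB x) (norm_nonneg _))

theorem memLp_jet_mul {Z : ℝ × ℝ × ℝ × ℝ → ℝ} (hZ : Continuous Z) {M : ℝ} {v f : ℝ → ℝ}
    (hv : ContDiff ℝ (3 : ℕ) v) (hvM : ∀ k ≤ 3, ∀ x, |iteratedDeriv k v x| ≤ M)
    (hf : MemLp f 2) : MemLp (fun x => Z (jet v x) * f x) 2 := by
  obtain ⟨A, _, hA⟩ := exists_bound_jet hZ M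
  exact MemLp.bdd_mul_two (hZ.comp (continuous_jet hv)) (hA v hvM) hf

theorem abs_integral_le_of_sq {f a b : ℝ → ℝ} {A B : ℝ} (ha : MemLp a 2) (hb : MemLp b 2)
    (hf : ∀ x, |f x| ≤ A * a x ^ 2 + B * b x ^ 2) :
    |∫ x, f x| ≤ A * (∫ x, a x ^ 2) + B * ∫ x, b x ^ 2 := by
  rw [← integral_const_mul, ← integral_const_mul,
    ← integral_add (ha.integrable_sq.const_mul A) (hb.integrable_sq.const_mul B)]
  exact norm_integral_le_of_norm_le (f := f) ((ha.integrable_sq.const_mul A).add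
    (hb.integrable_sq.const_mul B)) (ae_of_all _ fun x => hf x)

/-- The integrand is an exact derivative ∂ₓH plus a tame remainder. The term u_x u_xx yields
½ρκu_x², the term u u_xx yields rθv_x u u_x with θ = ρκ', and the residual u_x² cancels by `hρκ`.
The terms in u u_x form q u u_x, equal to ½∂ₓ(qu²) up to u², and `R` contributes ρuR. Since `H`
stops at ∂ₓˡ⁺¹v, the available regularity suffices to differentiate it. -/
theorem exists_flux_pairing_bound {s : ℕ} (hs : 4 ≤ s) {κ p ρ : ℝ → ℝ}
    (hκ : ContDiff ℝ (s + 2 : ℕ) κ) (hp : ContDiff ℝ (s + 1 : ℕ) p) (hρ : ContDiff ℝ (2 : ℕ) ρ)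
    (l : ℕ) (hl : 1 ≤ l) (hls : l ≤ s)
    (hρκ : ∀ y, deriv ρ y * κ y = (2 * l + 1) / 3 * (ρ y * deriv κ y)) (M : ℝ) :
    ∃ C : ℝ, 0 ≤ C ∧ ∀ v, Sob (s + 2) v → (∀ k ≤ 3, ∀ x, |iteratedDeriv k v x| ≤ M) →
      MemLp (iteratedDeriv l (flux κ p v)) 2 ∧
      |∫ x, iteratedDeriv l (flux κ p v) x * (deriv ρ (v x) * iteratedDeriv 1 v x *
        iteratedDeriv l v x + ρ (v x) * iteratedDeriv (l + 1) v x)| ≤ C * hSq s v := by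
  obtain ⟨α, β, R, hR, hG⟩ := exists_iteratedDeriv_flux hs hκ hp l hl hls
  obtain ⟨R', hR', hRd⟩ := (hR.weaken (r' := 0 + 1) (by lia) le_rfl le_rfl).exists_deriv
  obtain ⟨C1, _, hC1⟩ := hR.tame (s := s) (by lia) (by lia) M
  -- `R'` has total order at most l+3 ≤ s+3 and factors of order at most max(l, 3) ≤ s, just within
  -- reach of the tame estimate.
  obtain ⟨C2, hC20, hC2⟩ := hR'.tame (s := s) (by lia) (by lia) M
  have k1 := ContDiff.deriv_nat hκ
  have k2 := ContDiff.deriv_nat k1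
  have p1 := ContDiff.deriv_nat hp
  have ρ1 := ContDiff.deriv_nat hρ
  set r : ℝ := (2 * l + 1) / 3 with hr
  set θ : ℝ → ℝ := fun y => ρ y * deriv κ y with hθ
  have θ2 : ContDiff ℝ (2 : ℕ) θ := hρ.mul (contDiff_of_le k1 (by lia))
  have θ1 := ContDiff.deriv_nat θ2
  -- The coefficient of v_x² u u_x. The term -rθ' comes from integrating the u u_xx term by parts.
  set B : ℝ → ℝ := fun y => β * (ρ y * deriv (deriv κ) y) + (l + 1) * (deriv ρ y * deriv κ y) -
    r * deriv θ y with hB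
  have B1 : ContDiff ℝ (0 + 1 : ℕ) B :=
    ((contDiff_const.mul ((contDiff_of_le hρ (by lia)).mul (contDiff_of_le k2 (by lia)))).add
      (contDiff_const.mul (ρ1.mul (contDiff_of_le k1 (by lia))))).sub (contDiff_const.mul θ1)
  set P : ℝ → ℝ := fun y => ρ y * deriv p y with hP
  have P1 : ContDiff ℝ (0 + 1 : ℕ) P := (contDiff_of_le hρ (by lia)).mul (contDiff_of_le p1 (by lia))
  have cρ := hρ.continuous
  have cρ1 := ρ1.continuous
  have cκ := hκ.continuous
  have cκ1 := k1.continuous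
  have cκ2 := k2.continuous
  have cp1 := p1.continuous
  have cθ := θ2.continuous
  have cθ1 := θ1.continuous
  have cB := B1.continuous
  have cB1 := (ContDiff.deriv_nat B1).continuous
  have cP := P1.continuous
  have cP1 := (ContDiff.deriv_nat P1).continuous
  set q : ℝ × ℝ × ℝ × ℝ → ℝ := fun y => (α - r) * (θ y.1 * y.2.2.1) + B y.1 * y.2.1 ^ 2 + P y.1
    with hq
  have cq : Continuous q := by fun_prop
  -- What multiplies u² in the end: `lowerCoeff` times ∂ₓρ(v), minus ½∂ₓq. The third derivative of v
  -- enters through ∂ₓq.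
  set Z : ℝ × ℝ × ℝ × ℝ → ℝ := fun y =>
    deriv ρ y.1 * y.2.1 * (α * (deriv κ y.1 * y.2.2.1) + β * (deriv (deriv κ) y.1 * y.2.1 ^ 2) +
      deriv p y.1) - 1 / 2 * ((α - r) * (deriv θ y.1 * y.2.1 * y.2.2.1 + θ y.1 * y.2.2.2) +
      (deriv B y.1 * y.2.1 * y.2.1 ^ 2 + B y.1 * (2 * y.2.1 * y.2.2.1)) + deriv P y.1 * y.2.1)
    with hZ
  have cZ : Continuous Z := by fun_prop
  obtain ⟨A1, hA10, hA1⟩ := exists_bound_jet cZ M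
  obtain ⟨A2, hA20, hA2⟩ := exists_bound_jet (Z := fun y => ρ y.1) (by fun_prop) M
  refine ⟨(A1 + A2) + A2 * C2, by positivity, fun v hv hvM => ?_⟩
  have hv3 : ContDiff ℝ (3 : ℕ) v := contDiff_of_le hv.1 (by lia)
  set u := iteratedDeriv l v
  set u1 := iteratedDeriv (l + 1) v
  set u2 := iteratedDeriv (l + 2) v
  have mu : MemLp u 2 := hv.memLp (by lia)
  have mu1 : MemLp u1 2 := hv.memLp (by lia)
  have mu2 : MemLp u2 2 := hv.memLp (by lia)
  have mR := (hC1 v hv hvM).1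
  have mR' := (hC2 v hv hvM).1
  have mG : MemLp (iteratedDeriv l (flux κ p v)) 2 := by
    have t1 := memLp_jet_mul (Z := fun y => κ y.1) (by fun_prop) hv3 hvM mu2
    have t2 := memLp_jet_mul (Z := fun y => (l + 1) * (deriv κ y.1 * y.2.1)) (by fun_prop) hv3 hvM
      mu1
    have t3 := memLp_jet_mul (Z := fun y => α * (deriv κ y.1 * y.2.2.1) +
      β * (deriv (deriv κ) y.1 * y.2.1 ^ 2) + deriv p y.1) (by fun_prop) hv3 hvM mu
    have := ((t1.add t2).add t3).add mR
    rw [funext (hG v hv.1)]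
    exact this
  refine ⟨mG, ?_⟩
  set φ' : ℝ → ℝ := fun x => deriv ρ (v x) * iteratedDeriv 1 v x * u x + ρ (v x) * u1 x with hφ'
  have mφ' : MemLp φ' 2 :=
    (memLp_jet_mul (Z := fun y => deriv ρ y.1 * y.2.1) (by fun_prop) hv3 hvM mu).add
      (memLp_jet_mul (Z := fun y => ρ y.1) (by fun_prop) hv3 hvM mu1)
  have mρR : MemLp (fun x => ρ (v x) * R v x) 2 :=
    memLp_jet_mul (Z := fun y => ρ y.1) (by fun_prop) hv3 hvM mR
  have mρR' : MemLp (fun x => ρ (v x) * R' v x) 2 :=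
    memLp_jet_mul (Z := fun y => ρ y.1) (by fun_prop) hv3 hvM mR'
  set H : ℝ → ℝ := fun x =>
    u1 x * (1 / 2 * (ρ (v x) * κ (v x)) * u1 x + r * (θ (v x) * iteratedDeriv 1 v x) * u x) +
      u x * (1 / 2 * q (jet v x) * u x + ρ (v x) * R v x) with hH
  have iH : Integrable H := by
    have t1 := memLp_jet_mul (Z := fun y => 1 / 2 * (ρ y.1 * κ y.1)) (by fun_prop) hv3 hvM mu1
    have t2 := memLp_jet_mul (Z := fun y => r * (θ y.1 * y.2.1)) (by fun_prop) hv3 hvM mu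
    have t3 := memLp_jet_mul (Z := fun y => 1 / 2 * q y) (by fun_prop) hv3 hvM mu
    exact (integrable_mul_of_memLp mu1 (t1.add t2)).add (integrable_mul_of_memLp mu (t3.add mρR))
  set rem : ℝ → ℝ := fun x => u x * (Z (jet v x) * u x - ρ (v x) * R' v x) with hrem
  have irem : Integrable rem :=
    integrable_mul_of_memLp mu ((memLp_jet_mul cZ hv3 hvM mu).sub mρR')
  have iGφ := integrable_mul_of_memLp mG mφ'
  have dH : ∀ x, HasDerivAt H (iteratedDeriv l (flux κ p v) x * φ' x - rem x) x := fun x => by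
    have w0 := hasDerivAt_coeff hρ hv.1 x
    have K0 := hasDerivAt_coeff hκ hv.1 x
    have T0 := hasDerivAt_coeff θ2 hv.1 x
    have B0 := hasDerivAt_coeff B1 hv.1 x
    have P0 := hasDerivAt_coeff P1 hv.1 x
    have v1 := hv.hasDerivAt (l := 1) (by lia) x
    have v2 := hv.hasDerivAt (l := 2) (by lia) x
    have du := hv.hasDerivAt (l := l) (by lia) x
    have du1 := hv.hasDerivAt (l := l + 1) (by lia) x
    have dR := hRd v (contDiff_of_le hv.1 (by lia)) x
    have dq := (((T0.mul v2).const_mul (α - r)).add (B0.mul (v1.pow 2))).add P0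
    have dd := (du1.mul ((((w0.mul K0).const_mul (1 / 2)).mul du1).add
      (((T0.mul v1).const_mul r).mul du))).add
      (du.mul (((dq.const_mul (1 / 2)).mul du).add (w0.mul dR)))
    convert! dd using 1
    rw [hG v hv.1 x]
    have e := hρκ (v x)
    have eB : B (v x) = β * (ρ (v x) * deriv (deriv κ) (v x)) +
      (l + 1) * (deriv ρ (v x) * deriv κ (v x)) - r * deriv θ (v x) := rfl
    have eθ : θ (v x) = ρ (v x) * deriv κ (v x) := rfl
    have eP : P (v x) = ρ (v x) * deriv p (v x) := rfl
    simp only [hrem, hφ', hZ, jet, lowerCoeff, Pi.mul_apply, Pi.add_apply, Pi.pow_apply,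
      Nat.reduceAdd, Nat.cast_ofNat, Nat.add_one_sub_one, pow_one, eB, eP, eθ]
    change deriv ρ (v x) * κ (v x) = r * _ at e
    have er : (l : ℝ) = (3 * r - 1) / 2 := by rw [hr]; ring
    rw [er]
    simp only [u, u1]
    clear_value θ B P r
    -- The weight identity is used twice: on the term u u_xx, and on the u_x² term produced by
    -- differentiating ½ρκ.
    linear_combination (iteratedDeriv 1 v x * iteratedDeriv l v x * iteratedDeriv (l + 2) v x -
      1 / 2 * iteratedDeriv 1 v x * iteratedDeriv (l + 1) v x ^ 2) * e
  have hint := integral_eq_zero_of_hasDerivAt_of_integrable dH (iGφ.sub irem) iH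
  rw [integral_sub iGφ irem, sub_eq_zero] at hint
  rw [hint]
  refine (abs_integral_le_of_sq (A := A1 + A2) (B := A2) mu mR' fun x => ?_).trans ?_
  · have h1 := hA1 v hvM x
    have h2 := hA2 v hvM x
    simp only [jet] at h2
    have h3 : |u x| * |R' v x| ≤ u x ^ 2 + R' v x ^ 2 := by
      rw [← sq_abs (u x), ← sq_abs (R' v x)]
      nlinarith [sq_nonneg (|u x| - |R' v x|), sq_nonneg (|u x|), sq_nonneg (|R' v x|)]
    calc |rem x| = |Z (jet v x) * u x ^ 2 - ρ (v x) * (u x * R' v x)| := by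
          rw [hrem]; congr 1; ring
      _ ≤ |Z (jet v x)| * u x ^ 2 + |ρ (v x)| * (|u x| * |R' v x|) := by
          refine (abs_sub _ _).trans (le_of_eq ?_)
          rw [abs_mul, abs_mul, abs_mul, abs_of_nonneg (sq_nonneg (u x))]
      _ ≤ A1 * u x ^ 2 + A2 * (u x ^ 2 + R' v x ^ 2) := by gcongr
      _ = _ := by ring
  · have h1 := integral_sq_le_hSq hls v
    have h2 := (hC2 v hv hvM).2
    calc _ ≤ (A1 + A2) * hSq s v + A2 * (C2 * hSq s v) := by gcongr
      _ = _ := by ring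

/-! ### Differentiation in time -/

theorem memLp_add {f g : ℝ → ℝ} (hf : MemLp f 2) (hg : MemLp g 2) :
    MemLp (fun x => f x + g x) 2 := hf.add hg

theorem memLp_sub {f g : ℝ → ℝ} (hf : MemLp f 2) (hg : MemLp g 2) :
    MemLp (fun x => f x - g x) 2 := hf.sub hg

theorem memLp_of_neg {f : ℝ → ℝ} (hf : MemLp (fun x => -f x) 2) : MemLp f 2 := by
  have := hf.neg
  simp only [Pi.neg_def, neg_neg] at this
  exact this

theorem memLp_const_mul {f : ℝ → ℝ} (hf : MemLp f 2) (c : ℝ) :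
    MemLp (fun x => c * f x) 2 := hf.const_mul c

open Classical in
/-- The class of `f` in `L²(ℝ)`, zero when `f` is not square integrable. -/
noncomputable def toL2 (f : ℝ → ℝ) : Lp ℝ 2 (volume : Measure ℝ) :=
  if h : MemLp f 2 then h.toLp f else 0

theorem toL2_eq {f : ℝ → ℝ} (h : MemLp f 2) : toL2 f = h.toLp f := by rw [toL2, dif_pos h]

theorem toL2_coe {f : ℝ → ℝ} (h : MemLp f 2) : toL2 f =ᵐ[volume] f := by
  rw [toL2_eq h]; exact h.coeFn_toLp

theorem norm_toL2 {f : ℝ → ℝ} (h : MemLp f 2) : ‖toL2 f‖ = (eLpNorm f 2).toReal := by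
  rw [toL2_eq h, Lp.norm_toLp]

theorem inner_toL2 {f g : ℝ → ℝ} (hf : MemLp f 2) (hg : MemLp g 2) :
    inner ℝ (toL2 f) (toL2 g) = ∫ x, f x * g x := by
  rw [L2.inner_def]
  refine integral_congr_ae ?_
  filter_upwards [toL2_coe hf, toL2_coe hg] with x h1 h2
  rw [h1, h2]; simp [mul_comm]

theorem norm_toL2_sq {f : ℝ → ℝ} (hf : MemLp f 2) : ‖toL2 f‖ ^ 2 = ∫ x, f x ^ 2 := by
  rw [← real_inner_self_eq_norm_sq, inner_toL2 hf hf]; simp only [sq]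

theorem toL2_add {f g : ℝ → ℝ} (hf : MemLp f 2) (hg : MemLp g 2) :
    toL2 (fun x => f x + g x) = toL2 f + toL2 g := by
  rw [toL2_eq hf, toL2_eq hg, ← MemLp.toLp_add hf hg]; exact toL2_eq (hf.add hg)

theorem toL2_sub {f g : ℝ → ℝ} (hf : MemLp f 2) (hg : MemLp g 2) :
    toL2 (fun x => f x - g x) = toL2 f - toL2 g := by
  rw [toL2_eq hf, toL2_eq hg, ← MemLp.toLp_sub hf hg]; exact toL2_eq (hf.sub hg)

theorem toL2_const_mul {f : ℝ → ℝ} (hf : MemLp f 2) (c : ℝ) :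
    toL2 (fun x => c * f x) = c • toL2 f := by
  rw [toL2_eq hf, ← MemLp.toLp_const_smul c hf]; exact toL2_eq (hf.const_mul c)

theorem norm_toL2_mul_le {b f : ℝ → ℝ} {B : ℝ} (hb : ∀ x, |b x| ≤ B)
    (hbf : MemLp (fun x => b x * f x) 2) (hf : MemLp f 2) :
    ‖toL2 fun x => b x * f x‖ ≤ B * ‖toL2 f‖ := by
  refine Lp.norm_le_mul_norm_of_ae_le_mul ?_
  filter_upwards [toL2_coe hbf, toL2_coe hf] with x h1 h2
  rw [h1, h2, norm_mul]
  exact mul_le_mul_of_nonneg_right (hb x) (norm_nonneg _)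

theorem slope_toL2_sub {u : ℝ → ℝ → ℝ} {u' : ℝ → ℝ} {t τ : ℝ} (hτ : MemLp (u τ) 2)
    (ht : MemLp (u t) 2) (hu' : MemLp u' 2) :
    slope (fun τ => toL2 (u τ)) t τ - toL2 u' =
      toL2 (fun x => (τ - t)⁻¹ * (u τ x - u t x) - u' x) := by
  have hd := memLp_sub hτ ht
  rw [toL2_sub (memLp_const_mul hd _) hu', toL2_const_mul hd, toL2_sub hτ ht, slope_def_module]

theorem hasDerivWithinAt_toL2_of_tendsto {S : Set ℝ} {t : ℝ} {u : ℝ → ℝ → ℝ} {u' : ℝ → ℝ}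
    (hu : ∀ τ ∈ S, MemLp (u τ) 2) (ht : t ∈ S) (hu' : MemLp u' 2)
    (h : Tendsto (fun τ => eLpNorm (fun x => (τ - t)⁻¹ * (u τ x - u t x) - u' x) 2)
      (𝓝[S \ {t}] t) (𝓝 0)) :
    HasDerivWithinAt (fun τ => toL2 (u τ)) (toL2 u') S t := by
  rw [hasDerivWithinAt_iff_tendsto_slope, tendsto_iff_norm_sub_tendsto_zero]
  have h2 := (ENNReal.tendsto_toReal ENNReal.zero_ne_top).comp h
  refine h2.congr' ?_
  filter_upwards [self_mem_nhdsWithin] with τ hτ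
  rw [slope_toL2_sub (hu τ hτ.1) (hu t ht) hu',
    norm_toL2 (memLp_sub (memLp_const_mul (memLp_sub (hu τ hτ.1) (hu t ht)) _) hu')]
  rfl

/-- The product rule for a uniformly differentiable multiplier and an `L²`-valued map. -/
theorem hasDerivWithinAt_toL2_mul {S : Set ℝ} {t B B' : ℝ} {m u : ℝ → ℝ → ℝ} {m' u' : ℝ → ℝ}
    {g : ℝ → ℝ} (ht : t ∈ S) (hu : ∀ τ ∈ S, MemLp (u τ) 2) (hu' : MemLp u' 2)
    (hU : HasDerivWithinAt (fun τ => toL2 (u τ)) (toL2 u') S t)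
    (hmc : ∀ τ ∈ S, Continuous (m τ)) (hmb : ∀ τ ∈ S, ∃ A, ∀ x, |m τ x| ≤ A)
    (hB : ∀ x, |m t x| ≤ B) (hm'c : Continuous m') (hB' : ∀ x, |m' x| ≤ B')
    (hg : Tendsto g (𝓝[S \ {t}] t) (𝓝 0))
    (hm : ∀ᶠ τ in 𝓝[S \ {t}] t, ∀ x, |(τ - t)⁻¹ * (m τ x - m t x) - m' x| ≤ g τ) :
    HasDerivWithinAt (fun τ => toL2 fun x => m τ x * u τ x)
      (toL2 fun x => m' x * u t x + m t x * u' x) S t := by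
  have hmu : ∀ τ ∈ S, ∀ {f : ℝ → ℝ}, MemLp f 2 → MemLp (fun x => m τ x * f x) 2 := fun τ hτ f hf => by
    obtain ⟨A, hA⟩ := hmb τ hτ
    exact MemLp.bdd_mul_two (hmc τ hτ) hA hf
  have hm'u : ∀ {f : ℝ → ℝ}, MemLp f 2 → MemLp (fun x => m' x * f x) 2 := fun hf =>
    MemLp.bdd_mul_two hm'c hB' hf
  have hUc : Tendsto (fun τ => toL2 (u τ)) (𝓝[S \ {t}] t) (𝓝 (toL2 (u t))) :=
    hU.continuousWithinAt.mono_left (nhdsWithin_mono _ sdiff_subset)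
  have hU' := hU
  rw [hasDerivWithinAt_iff_tendsto_slope, tendsto_iff_norm_sub_tendsto_zero] at hU' ⊢
  have hUc' := tendsto_iff_norm_sub_tendsto_zero.1 hUc
  have lim : Tendsto (fun τ => g τ * ‖toL2 (u τ)‖ + B' * ‖toL2 (u τ) - toL2 (u t)‖ +
      B * ‖slope (fun τ => toL2 (u τ)) t τ - toL2 u'‖) (𝓝[S \ {t}] t) (𝓝 0) := by
    have := ((hg.mul hUc.norm).add (hUc'.const_mul B')).add (hU'.const_mul B)
    simpa using this
  refine squeeze_zero' (Eventually.of_forall fun _ => norm_nonneg _) ?_ lim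
  filter_upwards [self_mem_nhdsWithin, hm] with τ hτ hmτ
  have uτ := hu τ hτ.1
  have ut := hu t ht
  set k := (τ - t)⁻¹
  have mσ : MemLp (fun x => (k * (m τ x - m t x) - m' x) * u τ x) 2 :=
    MemLp.bdd_mul_two ((continuous_const.mul ((hmc τ hτ.1).sub (hmc t ht))).sub hm'c) hmτ uτ
  have md : MemLp (fun x => u τ x - u t x) 2 := uτ.sub ut
  have mr : MemLp (fun x => k * (u τ x - u t x) - u' x) 2 := (md.const_mul k).sub hu'
  -- The discrete product rule: error of the multiplier's quotient, increment of `u` against `m'`,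
  -- error of the quotient of `u`.
  have e : (fun x => k * (m τ x * u τ x - m t x * u t x) - (m' x * u t x + m t x * u' x)) =
      fun x => ((k * (m τ x - m t x) - m' x) * u τ x + m' x * (u τ x - u t x)) +
        m t x * (k * (u τ x - u t x) - u' x) := by
    funext x; ring
  rw [slope_toL2_sub (u := fun τ x => m τ x * u τ x) (hmu τ hτ.1 uτ) (hmu t ht ut)
    (memLp_add (hm'u ut) (hmu t ht hu')), e, toL2_add (memLp_add mσ (hm'u md)) (hmu t ht mr),
    toL2_add mσ (hm'u md)]
  refine (norm_add_le _ _).trans (add_le_add ((norm_add_le _ _).trans (add_le_add ?_ ?_)) ?_)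
  · exact norm_toL2_mul_le hmτ mσ uτ
  · rw [← toL2_sub uτ ut]; exact norm_toL2_mul_le hB' (hm'u md) md
  · rw [slope_toL2_sub uτ ut hu']; exact norm_toL2_mul_le hB (hmu t ht mr) mr

theorem exists_taylor_bound {ρ : ℝ → ℝ} (hρ : ContDiff ℝ (2 : ℕ) ρ) (M : ℝ) :
    ∃ K : ℝ, 0 ≤ K ∧ ∀ a b, |a| ≤ M → |b| ≤ M →
      |ρ b - ρ a - deriv ρ a * (b - a)| ≤ K * (b - a) ^ 2 := by
  have h1 := ContDiff.deriv_nat hρ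
  obtain ⟨K, hK, hb⟩ := exists_bound_coeff (ContDiff.deriv_nat h1).continuous M
  have hsub : ∀ a b, |a| ≤ M → |b| ≤ M → ∀ y ∈ uIcc a b, |y| ≤ M := fun a b ha hb y hy =>
    abs_le.2 (uIcc_subset_Icc (abs_le.1 ha) (abs_le.1 hb) hy)
  have hlip : ∀ a b, |a| ≤ M → |b| ≤ M → |deriv ρ b - deriv ρ a| ≤ K * |b - a| :=
    fun a b ha hb' => (convex_uIcc a b).norm_image_sub_le_of_norm_hasDerivWithin_le
      (fun y _ => (ContDiff.hasDerivAt_deriv h1 y).hasDerivWithinAt)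
      (fun y hy => hb y (hsub a b ha hb' y hy)) left_mem_uIcc right_mem_uIcc
  refine ⟨K, hK, fun a b ha hb' => ?_⟩
  have := (convex_uIcc a b).norm_image_sub_le_of_norm_hasDerivWithin_le
    (f := fun y => ρ y - deriv ρ a * y) (f' := fun y => deriv ρ y - deriv ρ a) (C := K * |b - a|)
    (fun y _ => by
      have := (ContDiff.hasDerivAt_deriv hρ y).sub ((hasDerivAt_id y).const_mul (deriv ρ a))
      rw [mul_one] at this
      exact this.hasDerivWithinAt)
    (fun y hy => (hlip a y ha (hsub a b ha hb' y hy)).trans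
      (mul_le_mul_of_nonneg_left (abs_sub_left_of_mem_uIcc hy) hK))
    left_mem_uIcc right_mem_uIcc
  simp only [Real.norm_eq_abs] at this
  calc _ = |ρ b - deriv ρ a * b - (ρ a - deriv ρ a * a)| := by congr 1; ring
    _ ≤ _ := this
    _ = K * |b - a| ^ 2 := by ring
    _ = _ := by rw [sq_abs]

/-- What the energy method uses of a solution: classical regularity in space, and the equation
`∂ₜ ∂ₓˡ v = -∂ₓ ∂ₓˡ (flux v)` in `L²` for `l ≤ s`. -/
structure Evolves (κ p : ℝ → ℝ) (s : ℕ) (T : ℝ) (v : ℝ → ℝ → ℝ) : Prop where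
  sob : ∀ t ∈ Icc 0 T, Sob (s + 2) (v t)
  timeDeriv : ∀ t ∈ Icc 0 T, ∀ l ≤ s, ∃ w : ℝ → ℝ, MemLp w 2 ∧
    HasWeakDeriv 1 (iteratedDeriv l (flux κ p (v t))) (fun x => -w x) ∧
    HasDerivWithinAt (fun τ => toL2 (iteratedDeriv l (v τ))) (toL2 w) (Icc 0 T) t

/-- The error of the difference quotient tends to 0 in L² together with its x-derivative, by the
evolution at orders 0 and 1, hence uniformly in x. This uniformity is what permits differentiating
ρ(v) as a multiplier. -/
theorem Evolves.uniform {κ p : ℝ → ℝ} {s : ℕ} (hs : 4 ≤ s) {T : ℝ} {v : ℝ → ℝ → ℝ}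
    (hκ : ContDiff ℝ (s + 2 : ℕ) κ) (hp : ContDiff ℝ (s + 1 : ℕ) p) (h : Evolves κ p s T v)
    {t : ℝ} (ht : t ∈ Icc 0 T) :
    (∃ A, ∀ x, |iteratedDeriv 1 (flux κ p (v t)) x| ≤ A) ∧
    ∃ g : ℝ → ℝ, Tendsto g (𝓝[Icc 0 T \ {t}] t) (𝓝 0) ∧ (∀ τ, 0 ≤ g τ) ∧
      ∀ τ ∈ Icc 0 T, ∀ x,
        |(τ - t)⁻¹ * (v τ x - v t x) - -iteratedDeriv 1 (flux κ p (v t)) x| ≤ g τ := by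
  obtain ⟨w0, m0, hw0, d0⟩ := h.timeDeriv t ht 0 (by lia)
  obtain ⟨w1, m1, hw1, d1⟩ := h.timeDeriv t ht 1 (by lia)
  have hF := contDiff_flux hκ hp (h.sob t ht).1
  set F := flux κ p (v t)
  have e0 : w0 =ᵐ[volume] fun x => -iteratedDeriv 1 F x := by
    have := hw0.ae_eq (by
      rw [iteratedDeriv_zero]; exact hasWeakDeriv_iteratedDeriv (contDiff_of_le hF (by lia : 1 ≤ s)))
    filter_upwards [this] with x hx
    rw [← hx, neg_neg]
  have hwd : HasWeakDeriv 1 (iteratedDeriv 1 F) (iteratedDeriv 2 F) :=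
    (hasWeakDeriv_iteratedDeriv (contDiff_of_le hF (by lia : 1 ≤ s))).step
      (hasWeakDeriv_iteratedDeriv (contDiff_of_le hF (by lia : 2 ≤ s)))
  have e1 : w1 =ᵐ[volume] fun x => -iteratedDeriv 2 F x := by
    filter_upwards [hw1.ae_eq hwd] with x hx
    rw [← hx, neg_neg]
  have n0 : MemLp (fun x => -iteratedDeriv 1 F x) 2 := m0.ae_eq e0
  have n1 : MemLp (fun x => -iteratedDeriv 2 F x) 2 := m1.ae_eq e1
  have E0 : toL2 w0 = toL2 fun x => -iteratedDeriv 1 F x := by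
    rw [toL2_eq m0, toL2_eq n0]; exact (MemLp.toLp_eq_toLp_iff _ _).2 e0
  have E1 : toL2 w1 = toL2 fun x => -iteratedDeriv 2 F x := by
    rw [toL2_eq m1, toL2_eq n1]; exact (MemLp.toLp_eq_toLp_iff _ _).2 e1
  rw [E0, hasDerivWithinAt_iff_tendsto_slope, tendsto_iff_norm_sub_tendsto_zero] at d0
  rw [E1, hasDerivWithinAt_iff_tendsto_slope, tendsto_iff_norm_sub_tendsto_zero] at d1
  have dd := d0.add d1
  rw [add_zero] at dd
  refine ⟨⟨_, fun x => Real.abs_le_sqrt (sq_le_integral_sq_add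
    (fun x => hasDerivAt_iteratedDeriv hF (by lia) x) (memLp_of_neg n0) (memLp_of_neg n1) x)⟩, _, dd, fun τ => by positivity, fun τ hτ x => ?_⟩
  have st := h.sob t ht
  have sτ := h.sob τ hτ
  rw [slope_toL2_sub (sτ.memLp (by lia)) (st.memLp (by lia)) n0,
    slope_toL2_sub (sτ.memLp (by lia)) (st.memLp (by lia)) n1]
  set k := (τ - t)⁻¹
  set f : ℝ → ℝ := fun x => k * (iteratedDeriv 0 (v τ) x - iteratedDeriv 0 (v t) x) -
    -iteratedDeriv 1 F x
  set f' : ℝ → ℝ := fun x => k * (iteratedDeriv 1 (v τ) x - iteratedDeriv 1 (v t) x) -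
    -iteratedDeriv 2 F x
  have mf : MemLp f 2 := (((sτ.memLp (by lia)).sub (st.memLp (by lia))).const_mul k).sub n0
  have mf' : MemLp f' 2 := (((sτ.memLp (by lia)).sub (st.memLp (by lia))).const_mul k).sub n1
  have hd : ∀ x, HasDerivAt f (f' x) x := fun x =>
    (((sτ.hasDerivAt (by lia) x).sub (st.hasDerivAt (by lia) x)).const_mul k).sub
      (hasDerivAt_iteratedDeriv hF (by lia) x).neg
  have hb := sq_le_integral_sq_add hd mf mf' x
  rw [← norm_toL2_sq mf, ← norm_toL2_sq mf'] at hb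
  have : |f x| ≤ ‖toL2 f‖ + ‖toL2 f'‖ := by
    refine abs_le_of_sq_le_sq ?_ (by positivity)
    nlinarith [norm_nonneg (toL2 f), norm_nonneg (toL2 f'),
      mul_nonneg (norm_nonneg (toL2 f)) (norm_nonneg (toL2 f'))]
  simpa [f] using this

/-- The derivative of the weighted energy. -/
theorem Evolves.hasDerivWithinAt_energy {κ p ρ : ℝ → ℝ} {s : ℕ} (hs : 4 ≤ s) {T : ℝ}
    {v : ℝ → ℝ → ℝ} (hκ : ContDiff ℝ (s + 2 : ℕ) κ) (hp : ContDiff ℝ (s + 1 : ℕ) p)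
    (hρ : ContDiff ℝ (2 : ℕ) ρ) (h : Evolves κ p s T v) {t : ℝ} (ht : t ∈ Icc 0 T) {l : ℕ}
    (hl : l ≤ s) {w : ℝ → ℝ} (hw : MemLp w 2)
    (hd : HasDerivWithinAt (fun τ => toL2 (iteratedDeriv l (v τ))) (toL2 w) (Icc 0 T) t) :
    HasDerivWithinAt (fun τ => ∫ x, ρ (v τ x) * iteratedDeriv l (v τ) x ^ 2)
      ((∫ x, w x * (ρ (v t x) * iteratedDeriv l (v t) x)) * 2 -
        ∫ x, deriv ρ (v t x) * iteratedDeriv 1 (flux κ p (v t)) x * iteratedDeriv l (v t) x ^ 2)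
      (Icc 0 T) t := by
  obtain ⟨⟨AF, hAF⟩, g, hg, hg0, hgb⟩ := h.uniform hs hκ hp ht
  have st := h.sob t ht
  have hF := contDiff_flux hκ hp st.1
  set F := flux κ p (v t)
  have bdd : ∀ τ ∈ Icc 0 T, ∃ A, ∀ x, |v τ x| ≤ A := fun τ hτ => by
    simpa using (h.sob τ hτ).exists_bound (l := 0) (by lia)
  obtain ⟨At, hAt⟩ := bdd t ht
  have hρ1 := ContDiff.deriv_nat hρ
  obtain ⟨K, hK, hT⟩ := exists_taylor_bound hρ (At + 1)
  obtain ⟨A1, hA1, hρA⟩ := exists_bound_coeff hρ1.continuous At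
  obtain ⟨A0, hA0, hρ0⟩ := exists_bound_coeff hρ.continuous At
  have hτ0 : Tendsto (fun τ => |τ - t|) (𝓝[Icc 0 T \ {t}] t) (𝓝 0) := by
    have : Tendsto (fun τ : ℝ => |τ - t|) (𝓝 t) (𝓝 |t - t|) := by
      apply Continuous.tendsto; fun_prop
    rw [sub_self, abs_zero] at this
    exact this.mono_left nhdsWithin_le_nhds
  -- Keeps v(τ) within distance 1 of v(t), so that the Taylor bound on |y| ≤ `At + 1` applies.
  have hsm : ∀ᶠ τ in 𝓝[Icc 0 T \ {t}] t, |τ - t| * (AF + g τ) < 1 := by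
    have : Tendsto (fun τ => |τ - t| * (AF + g τ)) (𝓝[Icc 0 T \ {t}] t) (𝓝 (0 * (AF + 0))) :=
      hτ0.mul (hg.const_add AF)
    rw [zero_mul] at this
    exact this.eventually (gt_mem_nhds one_pos)
  have hlim : Tendsto (fun τ => K * |τ - t| * (AF + g τ) ^ 2 + A1 * g τ)
      (𝓝[Icc 0 T \ {t}] t) (𝓝 0) := by
    have := ((hτ0.const_mul K).mul ((hg.const_add AF).pow 2)).add (hg.const_mul A1)
    simpa using this
  have hY := hasDerivWithinAt_toL2_mul (m := fun τ x => ρ (v τ x))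
    (u := fun τ => iteratedDeriv l (v τ)) (m' := fun x => deriv ρ (v t x) * -iteratedDeriv 1 F x)
    (B := A0) (B' := A1 * AF) ht
    (fun τ hτ => (h.sob τ hτ).memLp (by lia)) hw hd
    (fun τ hτ => hρ.continuous.comp (h.sob τ hτ).1.continuous)
    (fun τ hτ => by
      obtain ⟨A, hA⟩ := bdd τ hτ
      obtain ⟨A', _, hA'⟩ := exists_bound_coeff hρ.continuous A
      exact ⟨A', fun x => hA' _ (hA x)⟩)
    (fun x => hρ0 _ (hAt x))
    ((hρ1.continuous.comp st.1.continuous).mul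
      (hF.continuous_iteratedDeriv 1 (by exact_mod_cast (by lia : 1 ≤ s))).neg)
    (fun x => by
      rw [abs_mul, abs_neg]
      exact mul_le_mul (hρA _ (hAt x)) (hAF x) (abs_nonneg _) hA1) hlim (by
      filter_upwards [hsm, self_mem_nhdsWithin] with τ hτs hτ x
      have hne : τ - t ≠ 0 := sub_ne_zero.2 hτ.2
      have hb := hgb τ hτ.1 x
      set k := (τ - t)⁻¹ with hk
      set q := k * (v τ x - v t x) with hq
      have hq1 : |q| ≤ AF + g τ := by
        have h1 := abs_sub_abs_le_abs_sub q (-iteratedDeriv 1 F x)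
        rw [abs_neg] at h1
        have := hAF x
        linarith
      have hdiff : v τ x - v t x = (τ - t) * q := by rw [hq, hk]; field_simp
      have hvτ : |v τ x| ≤ At + 1 := by
        have h1 : |v τ x - v t x| ≤ 1 := by
          rw [hdiff, abs_mul]
          exact (mul_le_mul_of_nonneg_left hq1 (abs_nonneg _)).trans hτs.le
        have h2 := abs_sub_abs_le_abs_sub (v τ x) (v t x)
        have := hAt x
        linarith
      have hTay := hT (v t x) (v τ x) ((hAt x).trans (by linarith)) hvτ
      have e : k * (ρ (v τ x) - ρ (v t x)) - deriv ρ (v t x) * -iteratedDeriv 1 F x =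
          k * (ρ (v τ x) - ρ (v t x) - deriv ρ (v t x) * (v τ x - v t x)) +
            deriv ρ (v t x) * (q - -iteratedDeriv 1 F x) := by rw [hq]; ring
      rw [e]
      refine (abs_add_le _ _).trans (add_le_add ?_ ?_)
      · rw [abs_mul]
        calc _ ≤ |k| * (K * (v τ x - v t x) ^ 2) := by gcongr
          _ = K * |τ - t| * |q| ^ 2 := by
            rw [hdiff, hk, abs_inv, sq_abs, mul_pow, ← sq_abs (τ - t)]
            have : |τ - t| ≠ 0 := abs_ne_zero.2 hne
            field_simp
          _ ≤ _ := by gcongr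
      · rw [abs_mul]
        exact mul_le_mul (hρA _ (hAt x)) hb (abs_nonneg _) hA1)
  have mρ : ∀ τ ∈ Icc 0 T, ∀ {f : ℝ → ℝ}, MemLp f 2 → MemLp (fun x => ρ (v τ x) * f x) 2 :=
    fun τ hτ f hf => by
      obtain ⟨A, hA⟩ := bdd τ hτ
      obtain ⟨A', _, hA'⟩ := exists_bound_coeff hρ.continuous A
      exact MemLp.bdd_mul_two (hρ.continuous.comp (h.sob τ hτ).1.continuous)
        (fun x => hA' _ (hA x)) hf
  have mm : MemLp (fun x => deriv ρ (v t x) * -iteratedDeriv 1 F x * iteratedDeriv l (v t) x) 2 :=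
    MemLp.bdd_mul_two (B := A1 * AF) ((hρ1.continuous.comp st.1.continuous).mul
      (hF.continuous_iteratedDeriv 1 (by exact_mod_cast (by lia : 1 ≤ s))).neg)
      (fun x => by
        rw [abs_mul, abs_neg]
        exact mul_le_mul (hρA _ (hAt x)) (hAF x) (abs_nonneg _) hA1) (st.memLp (by lia))
  -- The energy is the L² inner product of ρ(v)u with u.
  have hE := hY.inner ℝ hd
  have mu : ∀ τ ∈ Icc 0 T, MemLp (iteratedDeriv l (v τ)) 2 := fun τ hτ => (h.sob τ hτ).memLp (by lia)
  rw [inner_toL2 (mρ t ht (mu t ht)) hw, inner_toL2 (memLp_add mm (mρ t ht hw)) (mu t ht)] at hE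
  have i1 := integrable_mul_of_memLp hw (mρ t ht (mu t ht))
  have i2 := integrable_mul_of_memLp mm (mu t ht)
  have i3 := integrable_mul_of_memLp (mρ t ht hw) (mu t ht)
  have eE : ((∫ x, w x * (ρ (v t x) * iteratedDeriv l (v t) x)) * 2 -
        ∫ x, deriv ρ (v t x) * iteratedDeriv 1 F x * iteratedDeriv l (v t) x ^ 2) =
      (∫ x, ρ (v t x) * iteratedDeriv l (v t) x * w x) +
        ∫ x, (deriv ρ (v t x) * -iteratedDeriv 1 F x * iteratedDeriv l (v t) x +
          ρ (v t x) * w x) * iteratedDeriv l (v t) x := by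
    have e1 : ∀ x, (deriv ρ (v t x) * -iteratedDeriv 1 F x * iteratedDeriv l (v t) x +
        ρ (v t x) * w x) * iteratedDeriv l (v t) x =
        deriv ρ (v t x) * -iteratedDeriv 1 F x * iteratedDeriv l (v t) x * iteratedDeriv l (v t) x +
          ρ (v t x) * w x * iteratedDeriv l (v t) x := fun x => by ring
    simp only [e1]
    rw [integral_add i2 i3]
    have e2 : ∀ x, ρ (v t x) * iteratedDeriv l (v t) x * w x =
        w x * (ρ (v t x) * iteratedDeriv l (v t) x) := fun x => by ring
    have e3 : ∀ x, ρ (v t x) * w x * iteratedDeriv l (v t) x =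
        w x * (ρ (v t x) * iteratedDeriv l (v t) x) := fun x => by ring
    have e4 : ∀ x, deriv ρ (v t x) * -iteratedDeriv 1 F x * iteratedDeriv l (v t) x *
        iteratedDeriv l (v t) x =
        -(deriv ρ (v t x) * iteratedDeriv 1 F x * iteratedDeriv l (v t) x ^ 2) := fun x => by ring
    simp only [e2, e3, e4]
    rw [integral_neg]
    ring
  rw [eE]
  have conv : ∀ τ ∈ Icc 0 T, ∫ x, ρ (v τ x) * iteratedDeriv l (v τ) x ^ 2 =
      inner ℝ (toL2 fun x => ρ (v τ x) * iteratedDeriv l (v τ) x)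
        (toL2 (iteratedDeriv l (v τ))) := fun τ hτ => by
    rw [inner_toL2 (mρ τ hτ (mu τ hτ)) (mu τ hτ)]
    exact integral_congr_ae (ae_of_all _ fun x => by ring)
  exact hE.congr conv (conv t ht)

/-! ### The a priori estimate -/

/-- The weight which turns the `l`-th order energy into a controlled quantity. -/
noncomputable def weight (κ : ℝ → ℝ) (l : ℕ) (y : ℝ) : ℝ := κ y ^ ((2 * l + 1) / 3 : ℝ)

theorem contDiff_weight {n : ℕ} {κ : ℝ → ℝ} (hκ : ContDiff ℝ n κ) (hpos : ∀ y, 0 < κ y) (l : ℕ) :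
    ContDiff ℝ n (weight κ l) :=
  hκ.rpow_const_of_ne fun y => (hpos y).ne'

theorem weight_pos {κ : ℝ → ℝ} (hpos : ∀ y, 0 < κ y) (l : ℕ) (y : ℝ) : 0 < weight κ l y :=
  Real.rpow_pos_of_pos (hpos y) _

theorem deriv_weight_mul {n : ℕ} {κ : ℝ → ℝ} (hκ : ContDiff ℝ (n + 1 : ℕ) κ)
    (hpos : ∀ y, 0 < κ y) (l : ℕ) (y : ℝ) :
    deriv (weight κ l) y * κ y = (2 * l + 1) / 3 * (weight κ l y * deriv κ y) := by
  have h : HasDerivAt (weight κ l) _ y :=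
    (ContDiff.hasDerivAt_deriv hκ y).rpow_const (p := (2 * l + 1) / 3) (Or.inl (hpos y).ne')
  have e : weight κ l y = κ y ^ ((2 * l + 1) / 3 - 1 : ℝ) * κ y := by
    rw [weight, ← Real.rpow_add_one (hpos y).ne']; congr 1; ring
  rw [h.deriv, e]; ring

/-- `∂ₓ` of the flux as a function of the jet. -/
noncomputable def fluxDeriv (κ p : ℝ → ℝ) (y : ℝ × ℝ × ℝ × ℝ) : ℝ :=
  κ y.1 * y.2.2.2 + 2 * (deriv κ y.1 * y.2.1) * y.2.2.1 +
    (1 / 2 * (deriv (deriv κ) y.1 * y.2.1 ^ 2) + deriv p y.1) * y.2.1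

theorem iteratedDeriv_one_flux_eq {s : ℕ} (hs : 4 ≤ s) {κ p : ℝ → ℝ}
    (hκ : ContDiff ℝ (s + 2 : ℕ) κ) (hp : ContDiff ℝ (s + 1 : ℕ) p) {v : ℝ → ℝ}
    (hv : ContDiff ℝ (s + 2 : ℕ) v) (x : ℝ) :
    iteratedDeriv 1 (flux κ p v) x = fluxDeriv κ p (jet v x) := by
  rw [iteratedDeriv_flux_one hs hκ hp hv, fluxDeriv, jet, lowerCoeff]; ring

theorem continuous_fluxDeriv {s : ℕ} {κ p : ℝ → ℝ}
    (hκ : ContDiff ℝ (s + 2 : ℕ) κ) (hp : ContDiff ℝ (s + 1 : ℕ) p) :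
    Continuous (fluxDeriv κ p) := by
  have c0 := hκ.continuous
  have c1 := (ContDiff.deriv_nat hκ).continuous
  have c2 := (ContDiff.deriv_nat (ContDiff.deriv_nat hκ)).continuous
  have c3 := (ContDiff.deriv_nat hp).continuous
  unfold fluxDeriv
  fun_prop

theorem exists_fluxDeriv_tame {s : ℕ} (hs : 4 ≤ s) {κ p : ℝ → ℝ}
    (hκ : ContDiff ℝ (s + 2 : ℕ) κ) (hp : ContDiff ℝ (s + 1 : ℕ) p) (M : ℝ) :
    ∃ C : ℝ, 0 ≤ C ∧ ∀ v, Sob (s + 2) v → (∀ k ≤ 3, ∀ x, |iteratedDeriv k v x| ≤ M) →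
      MemLp (fun x => fluxDeriv κ p (jet v x)) 2 ∧
      ∫ x, fluxDeriv κ p (jet v x) ^ 2 ≤ C * hSq s v := by
  have k1 := ContDiff.deriv_nat hκ
  have k2 := ContDiff.deriv_nat k1
  have p1 := ContDiff.deriv_nat hp
  have d1 : DiffPoly s 3 3 fun v x => κ (v x) * iteratedDeriv 3 v x :=
    .ofList [3] (contDiff_of_le hκ (by lia)) (by simp)
  have d2 : DiffPoly s 3 3 fun v x => 2 * deriv κ (v x) *
      (iteratedDeriv 1 v x * iteratedDeriv 2 v x) :=
    .ofList [1, 2] ((contDiff_const (c := 2)).mul (contDiff_of_le k1 (by lia))) (by simp)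
  have d3 : DiffPoly s 3 3 fun v x => 1 / 2 * deriv (deriv κ) (v x) *
      (iteratedDeriv 1 v x * (iteratedDeriv 1 v x * iteratedDeriv 1 v x)) :=
    .ofList [1, 1, 1] ((contDiff_const (c := 1 / 2)).mul k2) (by simp)
  have d4 : DiffPoly s 3 3 fun v x => deriv p (v x) * iteratedDeriv 1 v x :=
    .ofList [1] p1 (by simp)
  have d : DiffPoly s 3 3 fun v x => fluxDeriv κ p (jet v x) :=
    (((d1.add d2).add d3).add d4).congr fun v x => by rw [fluxDeriv, jet]; ring
  exact d.tame (by lia) (by lia) M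

/-- The rate of change of each energy is controlled by the square of the norm of `H^s`. -/
theorem exists_energy_rate {s : ℕ} (hs : 4 ≤ s) {κ p : ℝ → ℝ}
    (hκ : ContDiff ℝ (s + 2 : ℕ) κ) (hp : ContDiff ℝ (s + 1 : ℕ) p) (hpos : ∀ y, 0 < κ y) (M : ℝ)
    (l : ℕ) (hl : l ≤ s) :
    ∃ C : ℝ, 0 ≤ C ∧ ∀ T v, Evolves κ p s T v → ∀ t ∈ Icc 0 T,
      (∀ k ≤ 3, ∀ x, |iteratedDeriv k (v t) x| ≤ M) → ∃ D,
      HasDerivWithinAt (fun τ => ∫ x, weight κ l (v τ x) * iteratedDeriv l (v τ) x ^ 2) D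
        (Icc 0 T) t ∧ D ≤ C * hSq s (v t) := by
  have hρs := contDiff_weight hκ hpos l
  set ρ := weight κ l with hρd
  have hρ : ContDiff ℝ (2 : ℕ) ρ := contDiff_of_le hρs (by lia)
  have cρ := hρ.continuous
  have cρ1 := (ContDiff.deriv_nat hρ).continuous
  have cF := continuous_fluxDeriv hκ hp
  obtain ⟨A, hA, hAb⟩ := exists_bound_jet (Z := fun y => deriv ρ y.1 * fluxDeriv κ p y)
    (by fun_prop) M
  have main : ∃ C : ℝ, 0 ≤ C ∧ ∀ v, Sob (s + 2) v →
      (∀ k ≤ 3, ∀ x, |iteratedDeriv k v x| ≤ M) → ∀ w, MemLp w 2 →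
      HasWeakDeriv 1 (iteratedDeriv l (flux κ p v)) (fun x => -w x) →
      ∫ x, w x * (ρ (v x) * iteratedDeriv l v x) ≤ C * hSq s v := by
    -- At order 0 the flux need not be square integrable, as p(0) may be nonzero; but ∂ₓF is tame
    -- and pairs directly with ρ(v)v. For l ≥ 1 a derivative is first moved off ∂ₓˡF.
    rcases Nat.eq_zero_or_pos l with rfl | hl0
    · obtain ⟨C, hC, hCb⟩ := exists_fluxDeriv_tame hs hκ hp M
      obtain ⟨A', hA', hAb'⟩ := exists_bound_jet (Z := fun y => ρ y.1) (by fun_prop) M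
      refine ⟨A' * C + A', by positivity, fun v hv hvM w _ hw => ?_⟩
      have e0 : w =ᵐ[volume] fun x => -fluxDeriv κ p (jet v x) := by
        have hF := contDiff_of_le (contDiff_flux hκ hp hv.1) (by lia : 1 ≤ s)
        rw [iteratedDeriv_zero] at hw
        filter_upwards [hw.ae_eq (hasWeakDeriv_iteratedDeriv hF)] with x hx
        rw [← iteratedDeriv_one_flux_eq hs hκ hp hv.1, ← hx, neg_neg]
      have hb := hCb v hv hvM
      have e : ∫ x, w x * (ρ (v x) * iteratedDeriv 0 v x) =
          ∫ x, -fluxDeriv κ p (jet v x) * (ρ (v x) * iteratedDeriv 0 v x) :=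
        integral_congr_ae (e0.mono fun x hx => by simp only [hx])
      rw [e]
      refine (le_abs_self _).trans ((abs_integral_le_of_sq (A := A') (B := A') hb.1
        (hv.memLp (l := 0) (by lia)) fun x => ?_).trans ?_)
      · rw [abs_mul, abs_mul, abs_neg, ← sq_abs (fluxDeriv κ p (jet v x)),
          ← sq_abs (iteratedDeriv 0 v x)]
        have := hAb' v hvM x
        simp only [jet] at this
        calc _ = |ρ (v x)| * (|fluxDeriv κ p (jet v x)| * |iteratedDeriv 0 v x|) := by ring
          _ ≤ A' * (|fluxDeriv κ p (jet v x)| ^ 2 + |iteratedDeriv 0 v x| ^ 2) := by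
            gcongr
            nlinarith [sq_nonneg (|fluxDeriv κ p (jet v x)| - |iteratedDeriv 0 v x|),
              sq_nonneg (|fluxDeriv κ p (jet v x)|), sq_nonneg (|iteratedDeriv 0 v x|)]
          _ = _ := by ring
      · have h1 := integral_sq_le_hSq (l := 0) (by lia : 0 ≤ s) v
        calc _ ≤ A' * (C * hSq s v) + A' * hSq s v := by gcongr; exact hb.2
          _ = _ := by ring
    · obtain ⟨C, hC, hCb⟩ := exists_flux_pairing_bound hs hκ hp hρ l hl0 hl
        (deriv_weight_mul hκ hpos l) M
      refine ⟨C, hC, fun v hv hvM w mw hw => ?_⟩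
      obtain ⟨mG, hb⟩ := hCb v hv hvM
      have hv3 : ContDiff ℝ (3 : ℕ) v := contDiff_of_le hv.1 (by lia)
      have mφ : MemLp (fun x => ρ (v x) * iteratedDeriv l v x) 2 :=
        memLp_jet_mul (Z := fun y => ρ y.1) (by fun_prop) hv3 hvM (hv.memLp (by lia))
      have mφ' : MemLp (fun x => deriv ρ (v x) * iteratedDeriv 1 v x * iteratedDeriv l v x +
          ρ (v x) * iteratedDeriv (l + 1) v x) 2 :=
        memLp_add (memLp_jet_mul (Z := fun y => deriv ρ y.1 * y.2.1) (by fun_prop) hv3 hvM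
          (hv.memLp (by lia)))
          (memLp_jet_mul (Z := fun y => ρ y.1) (by fun_prop) hv3 hvM (hv.memLp (by lia)))
      have hF := contDiff_flux hκ hp hv.1
      have hdφ : ∀ x, HasDerivAt (fun x => ρ (v x) * iteratedDeriv l v x)
          (deriv ρ (v x) * iteratedDeriv 1 v x * iteratedDeriv l v x +
            ρ (v x) * iteratedDeriv (l + 1) v x) x := fun x =>
        (hasDerivAt_coeff hρ hv.1 x).mul (hv.hasDerivAt (by lia) x)
      have cv := hv.1.continuous
      have c1 := hv.continuous (l := 1) (by lia)
      have c2 := hv.continuous (l := l) (by lia)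
      have c3 := hv.continuous (l := l + 1) (by lia)
      have hw2 : MemLp (fun x => -w x) 2 := mw.neg
      have ibp := hw.integral_mul_deriv (hF.continuous_iteratedDeriv l (by exact_mod_cast hl)) hdφ
        (by fun_prop) (integrable_mul_of_memLp mG mφ) (integrable_mul_of_memLp mG mφ')
        (integrable_mul_of_memLp hw2 mφ)
      simp only [neg_mul, integral_neg, neg_neg] at ibp
      rw [← ibp]
      exact (le_abs_self _).trans hb
  obtain ⟨C, hC, hCb⟩ := main
  refine ⟨C * 2 + A, by positivity, fun T v hv t ht hvM => ?_⟩
  obtain ⟨w, mw, hw, hd⟩ := hv.timeDeriv t ht l hl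
  have st := hv.sob t ht
  refine ⟨_, hv.hasDerivWithinAt_energy hs hκ hp hρ ht hl mw hd, ?_⟩
  have h1 := hCb (v t) st hvM w mw hw
  have h2 := abs_integral_le_of_sq (A := A) (B := 0)
    (f := fun x => deriv ρ (v t x) * iteratedDeriv 1 (flux κ p (v t)) x *
      iteratedDeriv l (v t) x ^ 2) (st.memLp (l := l) (by lia)) (st.memLp (l := l) (by lia))
      fun x => by
        rw [zero_mul, add_zero, abs_mul, abs_of_nonneg (sq_nonneg (iteratedDeriv l (v t) x)),
          iteratedDeriv_one_flux_eq hs hκ hp st.1]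
        exact mul_le_mul_of_nonneg_right (hAb (v t) hvM x) (sq_nonneg _)
  rw [zero_mul, add_zero] at h2
  have h3 := mul_le_mul_of_nonneg_left (integral_sq_le_hSq hl (v t)) hA
  have h4 := neg_abs_le (∫ x, deriv ρ (v t x) * iteratedDeriv 1 (flux κ p (v t)) x *
      iteratedDeriv l (v t) x ^ 2)
  linarith

/-- The total weighted energy. -/
noncomputable def energy (κ : ℝ → ℝ) (s : ℕ) (v : ℝ → ℝ) : ℝ :=
  ∑ l ∈ Finset.range (s + 1), ∫ x, weight κ l (v x) * iteratedDeriv l v x ^ 2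

theorem exists_energy_equiv {s : ℕ} {κ : ℝ → ℝ} (hκ : ContDiff ℝ (s + 2 : ℕ) κ)
    (hpos : ∀ y, 0 < κ y) (M : ℝ) :
    ∃ C : ℝ, 0 ≤ C ∧ ∀ v, Sob (s + 2) v → (∀ x, |v x| ≤ M) →
      energy κ s v ≤ C * hSq s v ∧ hSq s v ≤ C * energy κ s v := by
  have hw : ∀ l, ∃ A : ℝ, 0 ≤ A ∧ ∀ y, |y| ≤ M → weight κ l y ≤ A ∧ 1 ≤ A * weight κ l y := by
    intro l
    have cw := (contDiff_weight hκ hpos l).continuous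
    obtain ⟨A, hA, h⟩ := exists_bound_coeff cw M
    obtain ⟨A', hA', h'⟩ := exists_bound_coeff (cw.inv₀ fun y => (weight_pos hpos l y).ne') M
    refine ⟨A + A', by positivity, fun y hy => ⟨?_, ?_⟩⟩
    · linarith [le_abs_self (weight κ l y), h y hy]
    · have h1 := h' y hy
      have h2 := weight_pos hpos l y
      rw [Pi.inv_apply, abs_of_pos (inv_pos.2 h2), inv_le_iff_one_le_mul₀ h2] at h1
      nlinarith [mul_nonneg hA h2.le]
  choose A hA hAb using hw
  have hAle : ∀ l ∈ Finset.range (s + 1), A l ≤ ∑ l ∈ Finset.range (s + 1), A l := fun l hl =>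
    Finset.single_le_sum (f := A) (fun i _ => hA i) hl
  refine ⟨∑ l ∈ Finset.range (s + 1), A l, Finset.sum_nonneg fun l _ => hA l, fun v hv hvM => ?_⟩
  have int : ∀ l ∈ Finset.range (s + 1),
      Integrable fun x => weight κ l (v x) * iteratedDeriv l v x ^ 2 := fun l hl => by
    rw [Finset.mem_range] at hl
    refine integrable_of_abs_le (((contDiff_weight hκ hpos l).continuous.comp
      hv.1.continuous).mul ((hv.continuous (by lia)).pow 2))
      ((hv.memLp (l := l) (by lia)).integrable_sq.const_mul (A l)) fun x => ?_
    rw [abs_of_nonneg (mul_nonneg (weight_pos hpos l _).le (sq_nonneg _))]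
    exact mul_le_mul_of_nonneg_right (hAb l _ (hvM x)).1 (sq_nonneg _)
  constructor
  · rw [energy, hSq, Finset.mul_sum]
    refine Finset.sum_le_sum fun l hl => ?_
    have hl' := Finset.mem_range.1 hl
    rw [← integral_const_mul]
    refine integral_mono (int l hl) ((hv.memLp (l := l) (by lia)).integrable_sq.const_mul _)
      fun x => mul_le_mul_of_nonneg_right ((hAb l _ (hvM x)).1.trans (hAle l hl)) (sq_nonneg _)
  · rw [energy, hSq, Finset.mul_sum]
    refine Finset.sum_le_sum fun l hl => ?_
    have hl' := Finset.mem_range.1 hl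
    rw [← integral_const_mul]
    refine integral_mono (hv.memLp (l := l) (by lia)).integrable_sq ((int l hl).const_mul _)
      fun x => ?_
    have h1 := (hAb l _ (hvM x)).2
    have h2 := mul_le_mul_of_nonneg_right (hAle l hl) (weight_pos hpos l (v x)).le
    simp only
    rw [← mul_assoc]
    exact le_mul_of_one_le_left (sq_nonneg _) (h1.trans h2)

theorem exists_hSq_le {s : ℕ} (hs : 4 ≤ s) {κ p : ℝ → ℝ} (hκ : ContDiff ℝ (s + 2 : ℕ) κ)
    (hp : ContDiff ℝ (s + 1 : ℕ) p) (hpos : ∀ y, 0 < κ y) (M : ℝ) :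
    ∃ A : ℝ, 0 ≤ A ∧ ∀ T v, Evolves κ p s T v → ∀ t ∈ Icc 0 T,
      (∀ τ ∈ Icc 0 t, ∀ k ≤ 3, ∀ x, |iteratedDeriv k (v τ) x| ≤ M) →
      hSq s (v t) ≤ (A * Real.exp (A * t)) ^ 2 * hSq s (v 0) := by
  obtain ⟨C, hC, hCb⟩ := exists_energy_equiv hκ hpos M
  choose! K hK hKb using exists_energy_rate hs hκ hp hpos M
  set k := ∑ l ∈ Finset.range (s + 1), K l with hk
  have hk0 : 0 ≤ k := Finset.sum_nonneg fun l hl => hK l (by rw [Finset.mem_range] at hl; lia)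
  -- The two comparisons of energy and norm give C², Grönwall gives exp(kCt); both are dominated by
  -- the square of A·exp(At) with A = C + kC.
  refine ⟨C + k * C, by positivity, fun T v hv t ht hvM => ?_⟩
  have hsub : Icc 0 t ⊆ Icc 0 T := Icc_subset_Icc_right ht.2
  have hvM0 : ∀ τ ∈ Icc 0 t, ∀ x, |v τ x| ≤ M := fun τ hτ x => by
    simpa using hvM τ hτ 0 (by lia) x
  have hE : ∀ τ ∈ Icc 0 t, ∃ D, HasDerivWithinAt (fun τ => energy κ s (v τ)) D (Icc 0 T) τ ∧
      D ≤ k * C * energy κ s (v τ) := fun τ hτ => by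
    choose! D hD hDb using fun l hl => hKb l hl T v hv τ (hsub hτ) (hvM τ hτ)
    refine ⟨∑ l ∈ Finset.range (s + 1), D l, HasDerivWithinAt.fun_sum fun l hl => hD l (by
      rw [Finset.mem_range] at hl; lia), ?_⟩
    calc _ ≤ ∑ l ∈ Finset.range (s + 1), K l * hSq s (v τ) := Finset.sum_le_sum fun l hl =>
          hDb l (by rw [Finset.mem_range] at hl; lia)
      _ = k * hSq s (v τ) := by rw [← Finset.sum_mul]
      _ ≤ k * (C * energy κ s (v τ)) := by
        gcongr; exact (hCb _ (hv.sob τ (hsub hτ)) (hvM0 τ hτ)).2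
      _ = _ := by ring
  choose! D hD hDb using hE
  have h0 : (0 : ℝ) ∈ Icc 0 t := ⟨le_rfl, ht.1⟩
  have gr := le_gronwallBound_of_liminf_deriv_right_le (f := fun τ => energy κ s (v τ)) (f' := D)
    (δ := energy κ s (v 0)) (K := k * C) (ε := 0) (a := 0) (b := t)
    (fun τ hτ => ((hD τ hτ).continuousWithinAt).mono hsub)
    (fun τ hτ r hr => by
      have hm : Icc 0 T ∈ 𝓝[≥] τ := Icc_mem_nhdsGE_of_mem ⟨hτ.1, hτ.2.trans_le ht.2⟩
      have := ((hD τ (Ico_subset_Icc_self hτ)).mono_of_mem_nhdsWithin hm).liminf_right_slope_le hr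
      simpa only [slope_def_module, smul_eq_mul] using this)
    le_rfl (fun τ hτ => by rw [add_zero]; exact hDb τ (Ico_subset_Icc_self hτ)) t ⟨ht.1, le_rfl⟩
  rw [gronwallBound_ε0, sub_zero] at gr
  have e1 := (hCb _ (hv.sob t ht) (hvM0 t ⟨ht.1, le_rfl⟩)).2
  have e2 := (hCb _ (hv.sob 0 (hsub h0)) (hvM0 0 h0)).1
  have hkC : 0 ≤ k * C := by positivity
  have hexp : Real.exp (k * C * t) ≤ Real.exp ((C + k * C) * t) ^ 2 := by
    rw [← Real.exp_nat_mul, Real.exp_le_exp]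
    push_cast
    nlinarith [mul_nonneg hC ht.1, mul_nonneg hkC ht.1]
  calc hSq s (v t) ≤ C * (C * hSq s (v 0) * Real.exp (k * C * t)) := by
        refine e1.trans (mul_le_mul_of_nonneg_left (gr.trans ?_) hC)
        gcongr
    _ = C ^ 2 * Real.exp (k * C * t) * hSq s (v 0) := by ring
    _ ≤ (C + k * C) ^ 2 * Real.exp ((C + k * C) * t) ^ 2 * hSq s (v 0) := by
      have := hSq_nonneg s (v 0)
      gcongr
      linarith
    _ = _ := by ring

/-! ### Norms in terms of classical derivatives -/

theorem eLpNorm_two_eq {f : ℝ → ℝ} (hf : MemLp f 2) :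
    eLpNorm f 2 ^ 2 = ENNReal.ofReal (∫ x, f x ^ 2) := by
  rw [← norm_toL2_sq hf, norm_toL2 hf, ENNReal.ofReal_pow ENNReal.toReal_nonneg,
    ENNReal.ofReal_toReal hf.2.ne]

theorem hNorm_eq {k s : ℕ} {v : ℝ → ℝ} (hv : Sob k v) (hs : s ≤ k) :
    hNorm s v = ENNReal.ofReal (hSq s v) ^ (1 / 2 : ℝ) := by
  rw [hNorm, hSq, ENNReal.ofReal_sum_of_nonneg fun _ _ => integral_sq_nonneg _]
  congr 1
  refine Finset.sum_congr rfl fun l hl => ?_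
  rw [Finset.mem_range] at hl
  rw [(hasWeakDeriv_iteratedDeriv (contDiff_of_le hv.1 (by lia : l ≤ k))).derivNorm_eq,
    eLpNorm_two_eq (hv.memLp (by lia))]

theorem derivNorm_le_hNorm {k l : ℕ} (hl : l ≤ k) (f : ℝ → ℝ) : derivNorm l 2 f ≤ hNorm k f := by
  have h : derivNorm l 2 f ^ 2 ≤ ∑ l ∈ Finset.range (k + 1), derivNorm l 2 f ^ 2 :=
    Finset.single_le_sum (f := fun l => derivNorm l 2 f ^ 2) (fun _ _ => zero_le)
      (Finset.mem_range.2 (by lia))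
  have h2 := ENNReal.rpow_le_rpow h (by norm_num : (0 : ℝ) ≤ 1 / 2)
  rw [← ENNReal.rpow_natCast, ← ENNReal.rpow_mul] at h2
  rw [hNorm]
  simpa using h2

theorem abs_le_of_eLpNorm_top_le {f : ℝ → ℝ} (hf : Continuous f) {B : ℝ} (hB : 0 ≤ B)
    (h : eLpNorm f ⊤ volume ≤ ENNReal.ofReal B) (x : ℝ) : |f x| ≤ B := by
  rw [eLpNorm_exponent_top] at h
  have hae : ∀ᵐ x, |f x| ≤ B := by
    filter_upwards [enorm_ae_le_eLpNormEssSup f volume] with x hx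
    have := hx.trans h
    rwa [← ofReal_norm, ENNReal.ofReal_le_ofReal_iff hB] at this
  by_contra hx
  have ho : IsOpen {x | ¬|f x| ≤ B} := by
    simp only [not_le]; exact isOpen_lt continuous_const hf.abs
  have := (ho.measure_eq_zero_iff volume).1 hae
  exact (this ▸ hx : x ∈ (∅ : Set ℝ))

theorem abs_iteratedDeriv_le_w3Sup {κ p : ℝ → ℝ} {s : ℕ} (hs : 4 ≤ s) {T : ℝ} {v : ℝ → ℝ → ℝ}
    (hv : Evolves κ p s T v) {t : ℝ} (ht : t ∈ Icc 0 T) (hfin : w3Sup v t < ⊤) {τ : ℝ}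
    (hτ : τ ∈ Icc 0 t) {k : ℕ} (hk : k ≤ 3) (x : ℝ) :
    |iteratedDeriv k (v τ) x| ≤ (w3Sup v t).toReal := by
  have st := hv.sob τ ⟨hτ.1, hτ.2.trans ht.2⟩
  refine abs_le_of_eLpNorm_top_le (st.continuous (by lia)) ENNReal.toReal_nonneg ?_ x
  rw [ENNReal.ofReal_toReal hfin.ne,
    ← (hasWeakDeriv_iteratedDeriv (contDiff_of_le st.1 (by lia : k ≤ s + 2))).derivNorm_eq ⊤]
  have h1 : derivNorm k ⊤ (v τ) ≤ wInfNorm 3 (v τ) :=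
    Finset.single_le_sum (f := fun l => derivNorm l ⊤ (v τ)) (fun _ _ => zero_le)
      (Finset.mem_range.2 (by lia))
  exact h1.trans (le_iSup₂ (f := fun τ (_ : τ ∈ Icc 0 t) => wInfNorm 3 (v τ)) τ hτ)

/-- The energy identity with weight 1 makes each ‖∂ₓˡv‖²_{L²}, l ≤ s, continuous on the compact
[0,T], hence bounded. Sobolev embedding at order 3 uses l = 4, hence s ≥ 4. -/
theorem w3Sup_lt_top {κ p : ℝ → ℝ} {s : ℕ} (hs : 4 ≤ s) (hκ : ContDiff ℝ (s + 2 : ℕ) κ)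
    (hp : ContDiff ℝ (s + 1 : ℕ) p) {T : ℝ} {v : ℝ → ℝ → ℝ}
    (hv : Evolves κ p s T v) {t : ℝ} (ht : t ∈ Icc 0 T) : w3Sup v t < ⊤ := by
  have hc : ∀ l ≤ s, ContinuousOn (fun τ => ∫ x, iteratedDeriv l (v τ) x ^ 2) (Icc 0 T) := by
    intro l hl τ hτ
    obtain ⟨w, mw, hw, hd⟩ := hv.timeDeriv τ hτ l hl
    have := (hv.hasDerivWithinAt_energy hs hκ hp (contDiff_const (c := 1)) hτ hl mw
      hd).continuousWithinAt
    simpa only [one_mul] using this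
  have hb : ∀ l ≤ s, ∃ B, ∀ τ ∈ Icc 0 T, ∫ x, iteratedDeriv l (v τ) x ^ 2 ≤ B := fun l hl => by
    obtain ⟨B, hB⟩ := isCompact_Icc.exists_bound_of_continuousOn (hc l hl)
    exact ⟨B, fun τ hτ => (le_abs_self _).trans (hB τ hτ)⟩
  choose! B hB using hb
  have key : w3Sup v t ≤ ∑ l ∈ Finset.range 4, ENNReal.ofReal √(B l + B (l + 1)) := by
    refine iSup₂_le fun τ hτ => Finset.sum_le_sum fun l hl => ?_
    rw [Finset.mem_range] at hl
    have hτT : τ ∈ Icc 0 T := ⟨hτ.1, hτ.2.trans ht.2⟩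
    have st := hv.sob τ hτT
    rw [(hasWeakDeriv_iteratedDeriv (contDiff_of_le st.1 (by lia : l ≤ s + 2))).derivNorm_eq,
      eLpNorm_exponent_top]
    refine eLpNormEssSup_le_of_ae_bound (ae_of_all _ fun x => Real.abs_le_sqrt ?_)
    exact (st.sq_le (by lia) x).trans (add_le_add (hB l (by lia) τ hτT) (hB (l + 1) (by lia) τ hτT))
  exact key.trans_lt (ENNReal.sum_lt_top.2 fun _ _ => ENNReal.ofReal_lt_top)

/-! ### From solutions to the evolution equation -/

theorem deriv_quasilinear_eq {s : ℕ} (hs : 4 ≤ s) {κ p v : ℝ → ℝ} (hκ : ContDiff ℝ (s + 2 : ℕ) κ)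
    (hp : ContDiff ℝ (s + 1 : ℕ) p) (hpos : ∀ y, 0 < κ y) (hv : ContDiff ℝ (s + 2 : ℕ) v) (x : ℝ) :
    deriv (fun y => p (v y)) x +
      deriv (fun y => √(κ (v y)) * deriv (fun z => √(κ (v z)) * deriv v z) y) x =
      iteratedDeriv 1 (flux κ p v) x := by
  have hinner : ∀ y, √(κ (v y)) * deriv (fun z => √(κ (v z)) * deriv v z) y =
      κ (v y) * iteratedDeriv 2 v y + 1 / 2 * (deriv κ (v y) * iteratedDeriv 1 v y ^ 2) := by
    intro y
    have h1 := (hasDerivAt_coeff hκ hv y).sqrt (hpos (v y)).ne'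
    have h2 := h1.mul (hasDerivAt_iteratedDeriv hv (l := 1) (by lia) y)
    have e : deriv (fun z => √(κ (v z)) * iteratedDeriv 1 v z) y = _ := h2.deriv
    rw [← iteratedDeriv_one (f := v), e]
    have hs0 : √(κ (v y)) ≠ 0 := (Real.sqrt_pos.2 (hpos _)).ne'
    have hs2 := Real.sq_sqrt (hpos (v y)).le
    field_simp
    rw [hs2]
    ring
  rw [funext hinner]
  have c0 := hasDerivAt_coeff hκ hv x
  have c1 := hasDerivAt_coeff (ContDiff.deriv_nat hκ) hv x
  have c2 := hasDerivAt_coeff hp hv x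
  have v1 := hasDerivAt_iteratedDeriv hv (l := 1) (by lia) x
  have v2 := hasDerivAt_iteratedDeriv hv (l := 2) (by lia) x
  have h := (c0.mul v2).add ((c1.mul (v1.pow 2)).const_mul (1 / 2))
  have e1 : deriv (fun y => κ (v y) * iteratedDeriv 2 v y +
      1 / 2 * (deriv κ (v y) * iteratedDeriv 1 v y ^ 2)) x = _ := h.deriv
  have e2 : deriv (flux κ p v) x = _ := (h.add c2).deriv
  rw [e1, c2.deriv, iteratedDeriv_one (f := flux κ p v), e2, add_comm]

/-- The equation says that ∂ₓF = -w almost everywhere, and w lies in H^s. So F has weak derivatives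
up to order s+1, one more than its classical regularity provides. Time differentiability in L² at
each order l ≤ s follows from the H^s limit. -/
theorem IsSolution.evolves {s : ℕ} (hs : 4 ≤ s) {κ p κ' p' : ℝ → ℝ}
    (hκ : ContDiff ℝ (s + 2 : ℕ) κ) (hp : ContDiff ℝ (s + 1 : ℕ) p) (hpos : ∀ y, 0 < κ y) {T : ℝ}
    {v₀ : ℝ → ℝ} {v : ℝ → ℝ → ℝ} (hv : IsSolution κ' p' (s + 3) T v₀ v)
    (hκ' : ∀ t ∈ Icc 0 T, ∀ x, κ' (v t x) = κ (v t x))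
    (hp' : ∀ t ∈ Icc 0 T, ∀ x, p' (v t x) = p (v t x)) : Evolves κ p s T v := by
  have sob : ∀ t ∈ Icc 0 T, Sob (s + 2) (v t) := fun t ht =>
    MemH.sob (hv.continuousInH t ht).1 (hv.continuous t ht)
  refine ⟨sob, fun t ht l hl => ?_⟩
  obtain ⟨w, hwH, hwd, heq⟩ := hv.equation
  rw [Nat.add_sub_cancel] at hwH hwd
  obtain ⟨wl, hwl, mwl⟩ := (hwH t ht).1 l hl
  have hF := contDiff_flux hκ hp (sob t ht).1
  set F := flux κ p (v t) with hFd
  have hw : iteratedDeriv 1 F =ᵐ[volume] fun x => -1 * w t x := by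
    filter_upwards [heq t ht] with x hx
    simp only [hκ' t ht, hp' t ht] at hx
    rw [add_assoc, deriv_quasilinear_eq hs hκ hp hpos (sob t ht).1] at hx
    linarith
  have hFw : HasWeakDeriv 1 F (fun x => -1 * w t x) :=
    (hasWeakDeriv_iteratedDeriv (contDiff_of_le hF (by lia : 1 ≤ s))).congr_ae ae_eq_rfl hw
  have hFl : HasWeakDeriv 1 (iteratedDeriv l F) (fun x => -1 * wl x) :=
    (hasWeakDeriv_iteratedDeriv (contDiff_of_le hF hl)).step (hFw.of_deriv (hwl.const_mul (-1)))
  refine ⟨wl, mwl, by simpa using hFl, ?_⟩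
  refine hasDerivWithinAt_toL2_of_tendsto (u := fun τ => iteratedDeriv l (v τ))
    (fun τ hτ => (sob τ hτ).memLp (by lia)) ht mwl ?_
  refine tendsto_of_tendsto_of_tendsto_of_le_of_le' tendsto_const_nhds (hwd t ht)
    (Eventually.of_forall fun _ => zero_le) ?_
  filter_upwards [self_mem_nhdsWithin] with τ hτ
  have h1 := hasWeakDeriv_iteratedDeriv (contDiff_of_le (sob τ hτ.1).1 (by lia : l ≤ s + 2))
  have h2 := hasWeakDeriv_iteratedDeriv (contDiff_of_le (sob t ht).1 (by lia : l ≤ s + 2))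
  rw [← (((h1.sub h2).const_mul (τ - t)⁻¹).sub hwl).derivNorm_eq 2]
  simp only [div_eq_inv_mul]
  exact derivNorm_le_hNorm hl _

/-- The convex hull of J lies in I because I is an interval. Extending log κ rather than κ keeps the
extension positive on the whole line. -/
theorem exists_extension {n m : ℕ} {I J : Set ℝ} (hI : I.OrdConnected) (hJ : IsCompact J)
    (hJI : J ⊆ I) {κ p : ℝ → ℝ} (hκ : ContDiffOn ℝ n κ I) (hpos : ∀ y ∈ I, 0 < κ y)
    (hp : ContDiffOn ℝ m p I) :
    ∃ κ' p' : ℝ → ℝ, ContDiff ℝ n κ' ∧ ContDiff ℝ m p' ∧ (∀ y, 0 < κ' y) ∧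
      (∀ y ∈ J, κ y = κ' y) ∧ ∀ y ∈ J, p y = p' y := by
  rcases J.eq_empty_or_nonempty with rfl | hne
  · exact ⟨fun _ => 1, fun _ => 0, contDiff_const, contDiff_const, fun _ => one_pos, by simp, by simp⟩
  have ha := hJ.sInf_mem hne
  have hb := hJ.sSup_mem hne
  have hsub : J ⊆ Icc (sInf J) (sSup J) := fun y hy =>
    ⟨csInf_le hJ.bddBelow hy, le_csSup hJ.bddAbove hy⟩
  have hK : Icc (sInf J) (sSup J) ⊆ I := hI.out (hJI ha) (hJI hb)
  have hab : sInf J ≤ sSup J := (hsub ha).2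
  obtain ⟨L, hL, hLe⟩ := exists_contDiff_eqOn_Icc n hab
    ((hκ.log fun y hy => (hpos y hy).ne').mono hK)
  obtain ⟨q, hq, hqe⟩ := exists_contDiff_eqOn_Icc m hab (hp.mono hK)
  refine ⟨fun y => Real.exp (L y), q, hL.exp, hq, fun y => Real.exp_pos _, fun y hy => ?_,
    fun y hy => (hqe (hsub hy)).symm⟩
  simp only
  rw [hLe (hsub hy), Real.exp_log (hpos y (hJI hy))]

theorem hNorm_le_of_hSq_le {k s : ℕ} {u v : ℝ → ℝ} (hu : Sob k u) (hv : Sob k v) (hs : s ≤ k)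
    {B B' : ℝ} (hB : 0 ≤ B) (hBB' : B ≤ B') (h : hSq s u ≤ B ^ 2 * hSq s v) :
    hNorm s u ≤ ENNReal.ofReal B' * hNorm s v := by
  rw [hNorm_eq hu hs, hNorm_eq hv hs]
  have h1 : ENNReal.ofReal (hSq s u) ≤ ENNReal.ofReal B' ^ 2 * ENNReal.ofReal (hSq s v) := by
    rw [← ENNReal.ofReal_pow (hB.trans hBB'), ← ENNReal.ofReal_mul (by positivity)]
    refine ENNReal.ofReal_le_ofReal (h.trans ?_)
    have := hSq_nonneg s v
    gcongr
  refine (ENNReal.rpow_le_rpow h1 (by norm_num : (0 : ℝ) ≤ 1 / 2)).trans_eq ?_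
  rw [ENNReal.mul_rpow_of_nonneg _ _ (by norm_num), ← ENNReal.rpow_natCast, ← ENNReal.rpow_mul]
  norm_num

end QKdV



theorem mainTheorem4 (s : ℕ) (hs : 4 ≤ s)
    (I : Set ℝ) (hI : I.OrdConnected) (J : Set ℝ) (hJ : IsCompact J) (hJI : J ⊆ I)
    (κ p : ℝ → ℝ) (hκ : ContDiffOn ℝ (s + 2 : ℕ) κ I) (hκpos : ∀ y ∈ I, 0 < κ y)
    (hp : ContDiffOn ℝ (s + 1 : ℕ) p I) :
    ∃ C : ℝ → ℝ, Monotone C ∧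
      ∀ (T : ℝ) (_ : 0 < T) (v₀ : ℝ → ℝ) (_ : QKdV.MemH s v₀) (v : ℝ → ℝ → ℝ)
        (_ : QKdV.IsSolution κ p (s + 3) T v₀ v)
        (_ : ∀ t ∈ Icc 0 T, ∀ x, v t x ∈ J),
        ∀ t ∈ Icc 0 T,
          QKdV.w3Sup v t < ⊤ ∧
          QKdV.hNorm s (v t) ≤
            ENNReal.ofReal (C (QKdV.w3Sup v t).toReal *
              Real.exp (C (QKdV.w3Sup v t).toReal * t)) * QKdV.hNorm s v₀ := by
  obtain ⟨κ', p', hκ', hp', hpos, eκ, ep⟩ := QKdV.exists_extension hI hJ hJI hκ hκpos hp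
  choose A hA hAb using fun k : ℕ => QKdV.exists_hSq_le hs hκ' hp' hpos (k : ℝ)
  -- Constants are chosen for integer bounds only; summing them up to ⌈x⌉₊ gives a nondecreasing
  -- function although `A` need not be monotone.
  refine ⟨fun x => ∑ k ∈ Finset.range (⌈x⌉₊ + 1), A k, fun x y hxy => ?_, ?_⟩
  · refine Finset.sum_le_sum_of_subset_of_nonneg (Finset.range_mono ?_) fun k _ _ => hA k
    exact Nat.add_le_add_right (Nat.ceil_mono hxy) 1
  intro T _ v₀ _ v hv hvJ t ht
  have hE := hv.evolves hs hκ' hp' hpos (fun t ht x => eκ _ (hvJ t ht x))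
    fun t ht x => ep _ (hvJ t ht x)
  have hfin := QKdV.w3Sup_lt_top hs hκ' hp' hE ht
  refine ⟨hfin, ?_⟩
  set M := (QKdV.w3Sup v t).toReal with hM
  have hAC : A ⌈M⌉₊ ≤ ∑ k ∈ Finset.range (⌈M⌉₊ + 1), A k :=
    Finset.single_le_sum (fun k _ => hA k) (Finset.self_mem_range_succ _)
  have hb := hAb ⌈M⌉₊ T v hE t ht fun τ hτ k hk x =>
    (QKdV.abs_iteratedDeriv_le_w3Sup hs hE ht hfin hτ hk x).trans (Nat.le_ceil M)
  have h0 : (0 : ℝ) ∈ Icc 0 T := ⟨le_rfl, ht.1.trans ht.2⟩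
  rw [← hv.initial]
  refine QKdV.hNorm_le_of_hSq_le (hE.sob t ht) (hE.sob 0 h0) (by lia)
    (mul_nonneg (hA _) (Real.exp_pos _).le) ?_ hb
  have hA0 := hA ⌈M⌉₊
  have ht0 := ht.1
  gcongr
  exact hA0.trans hAC
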